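/- Let $\mathbb{D}=\{z\in\mathbb{C}:|z|<1\}$. Given numbers $\alpha_{n,N}\in\mathbb{D}$ ($n,N\in\mathbb{N}_0$), let $\Phi_{n,N}$ be the monic polynomials of degree $n$ generated by $\Phi_{0,N}(z)=1$ and $$\Phi_{n+1,N}(z)=z\Phi_{n,N}(z)-\overline{\alpha_{n,N}}\,\Phi^*_{n,N}(z),\qquad \Phi^*_{n,N}(z)=z^n\,\overline{\Phi_{n,N}(1/\bar z)},$$ and, for $n\ge1$, let $\nu_{n,N}=\frac1n\sum_{j=1}^n\delta_{z_{j,n,N}}$ be the counting measure of the zeros $z_{1,n,N},\dots,z_{n,n,N}$ of $\Phi_{n,N}$, repeated according to multiplicity. For a probability measure $\mu$ on $\overline{\mathbb{D}}$ let $\mathcal{P}(\mu)$ denote its balayage onto $\partial\mathbb{D}$, that is, the probability measure on $\partial\mathbb{D}$ such that, for every continuous $f:\partial\mathbb{D}\to\mathbb{C}$, $\int f\,d\mathcal{P}(\mu)=\int_{\overline{\mathbb{D}}}\mathcal{P}_*f\,d\mu$, where $$\mathcal{P}_*f(z)=\frac1{2\pi}\int_0^{2\pi}\frac{1-|z|^2}{|e^{i\theta}-z|^2}f(e^{i\theta})\,d\theta\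 \text{ if } |z|<1,\qquad \mathcal{P}_*f(z)=f(z)\ \text{ if } |z|=1;$$ equivalently, it is the unique probability measure on $\partial\mathbb{D}$ with $\int z^k\,d\mathcal{P}(\mu)=\int z^k\,d\mu$ for all $k\in\mathbb{N}_0$. For $0\le a<1$ let $\theta_a=2\arcsin a$ and let $\nu_a$ be the probability measure on the arc $\{e^{i\theta}:\theta_a\le\theta\le2\pi-\theta_a\}$ with $$\frac{d\nu_a}{d\theta}(e^{i\theta})=\frac1{2\pi}\,\frac{\sin(\theta/2)}{\sqrt{\cos^2(\theta_a/2)-\cos^2(\theta/2)}};$$ put $\nu_1=\delta_{-1}$. The notation $\lim_{n/N\to s}X_{n,N}=X$ means that $X_{n_j,N_j}\to X$ for all sequences of positive integers with $n_j\to\infty$, $N_j\to\infty$ and $n_j/N_j\to s$. **Theorem 5.1.** Let $t>0$, let $\alpha:[0,t]\to\overline{\mathbb{D}}$ be Lebesgue measurable, and let $\{\alpha_{n,N}\}_{n,N\in\mathbb{N}_0}\subset\mathbb{D}$ be such that $$\lim_{n/N\to s}\alpha_{n,N}=\alpha(s)\quad\text{for a.e. } s\in[0,t].$$ Then, in the sense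 of weak convergence of measures, $$\lim_{n/N\to t}\mathcal{P}(\nu_{n,N})=\frac1t\int_0^t\nu_{|\alpha(s)|}\,ds,$$ where the right-hand side is the measure $B\mapsto\frac1t\int_0^t\nu_{|\alpha(s)|}(B)\,ds$. -/

import Mathlib

open MeasureTheory Filter Topology Polynomial
open scoped ENNReal

namespace VaryingOPUC

noncomputable section

/-- The reversed polynomial `p*(z) = z ^ n * conj (p (1 / conj z))` of a polynomial `p` of degree
at most `n`: conjugate the coefficients and reverse their order. -/
def reversed (n : ℕ) (p : ℂ[X]) : ℂ[X] :=
  (p.map (starRingEnd ℂ)).reflect n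

theorem eval_reversed (n : ℕ) (p : ℂ[X]) (hp : p.natDegree ≤ n) (z : ℂ) (hz : z ≠ 0) :
    (reversed n p).eval z = z ^ n * starRingEnd ℂ (p.eval (1 / starRingEnd ℂ z)) := by
  have hz' : z⁻¹ ≠ 0 := inv_ne_zero hz
  let i : Invertible z⁻¹ := invertibleOfNonzero hz'
  have h := eval₂_reflect_mul_pow (RingHom.id ℂ) z⁻¹ n (p.map (starRingEnd ℂ))
    ((natDegree_map_le).trans hp)
  rw [invOf_eq_inv, inv_inv] at h
  have h2 : eval z⁻¹ (p.map (starRingEnd ℂ))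
      = starRingEnd ℂ (p.eval (1 / starRingEnd ℂ z)) := by
    have := Polynomial.hom_eval₂ p (RingHom.id ℂ) (starRingEnd ℂ) (1 / starRingEnd ℂ z)
    simp only [RingHom.comp_id, map_div₀, map_one, RingHomCompTriple.comp_apply,
      RingHom.id_apply] at this
    rw [eval_map, ← one_div, ← this]
    rfl
  rw [← h2]
  change eval z (reflect n _) * _ = eval z⁻¹ _ at h
  rw [← h, reversed, inv_pow, mul_comm, mul_assoc, inv_mul_cancel₀ (pow_ne_zero n hz), mul_one]

/-- The monic orthogonal polynomials on the unit circle with Verblunsky coefficients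
`a 0, a 1, …`, generated by the Szegő recurrence. -/
def opuc (a : ℕ → ℂ) : ℕ → ℂ[X]
  | 0 => 1
  | n + 1 => X * opuc a n - C (starRingEnd ℂ (a n)) * reversed n (opuc a n)

theorem opuc_monic_natDegree (a : ℕ → ℂ) (n : ℕ) :
    (opuc a n).Monic ∧ (opuc a n).natDegree = n := by
  induction n with
  | zero => simp [opuc]
  | succ n ih =>
    obtain ⟨hm, hd⟩ := ih
    have hX : (X * opuc a n).Monic := monic_X.mul hm
    have hXd : (X * opuc a n).degree = ((n + 1 : ℕ) : WithBot ℕ) := by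
      rw [degree_eq_natDegree hX.ne_zero, natDegree_X_mul hm.ne_zero, hd]
    have hr : (reversed n (opuc a n)).natDegree ≤ n := by
      refine natDegree_reflect_le.trans (max_le le_rfl (natDegree_map_le.trans hd.le))
    have hlt : (C (starRingEnd ℂ (a n)) * reversed n (opuc a n)).degree
        < (X * opuc a n).degree := by
      rw [hXd]
      refine lt_of_le_of_lt (degree_le_of_natDegree_le ((natDegree_C_mul_le _ _).trans hr)) ?_
      exact_mod_cast Nat.lt_succ_self n
    refine ⟨hX.sub_of_left hlt, ?_⟩
    refine natDegree_eq_of_degree_eq_some ?_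
    rw [opuc, degree_sub_eq_left_of_degree_lt hlt, hXd]

theorem multiset_sum_dirac_univ (s : Multiset ℂ) :
    (s.map (Measure.dirac : ℂ → Measure ℂ)).sum Set.univ = s.card := by
  induction s using Multiset.induction_on with
  | empty => simp
  | cons z s ih => simp [ih, add_comm]

/-- The normalized zero-counting measure of a polynomial of degree `n ≥ 1`:
`(1 / n) ∑ δ_z`, the sum running over the zeros `z` counted with multiplicity. -/
def zeroMeasureOf (n : ℕ) (p : ℂ[X]) : Measure ℂ :=
  (n : ℝ≥0∞)⁻¹ • (p.roots.map Measure.dirac).sum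

/-- The zero-counting measure of the `n`-th orthogonal polynomial (a probability measure for
`n ≥ 1`; the zero measure for `n = 0`). -/
def zeroMeasure (a : ℕ → ℂ) (n : ℕ) : FiniteMeasure ℂ :=
  ⟨zeroMeasureOf n (opuc a n), ⟨by
    obtain ⟨hm, hd⟩ := opuc_monic_natDegree a n
    rw [zeroMeasureOf, Measure.smul_apply, multiset_sum_dirac_univ, smul_eq_mul,
      splits_iff_card_roots.1 (IsAlgClosed.splits _), hd]
    exact lt_of_le_of_lt (ENNReal.inv_mul_le_one _) ENNReal.one_lt_top⟩⟩

theorem isProbabilityMeasure_zeroMeasure (a : ℕ → ℂ) (n : ℕ) (hn : n ≠ 0) :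
    IsProbabilityMeasure (zeroMeasure a n : Measure ℂ) := by
  obtain ⟨hm, hd⟩ := opuc_monic_natDegree a n
  constructor
  change zeroMeasureOf n (opuc a n) Set.univ = 1
  rw [zeroMeasureOf, Measure.smul_apply, multiset_sum_dirac_univ, smul_eq_mul,
      splits_iff_card_roots.1 (IsAlgClosed.splits _), hd]
  exact ENNReal.inv_mul_cancel (by exact_mod_cast hn) (by simp)

/-- The image on the unit circle of the measure `f θ dθ` on the interval `I` under
`θ ↦ exp (i θ)`. -/
def circleDensity (I : Set ℝ) (f : ℝ → ℝ) : Measure ℂ :=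
  ((volume.restrict I).withDensity fun θ => ENNReal.ofReal (f θ)).map (circleMap 0 1)

/-- The balayage of the unit mass at a point `z` of the closed unit disk onto the unit circle:
the measure with density `P_r(φ - θ) / 2π` (the Poisson kernel) at `exp (i θ)` if
`z = r exp (i φ)` with `r < 1`, and the unit mass at `z` if `|z| = 1`.
(Points outside the closed disk play no role; their mass is left where it is.) -/
def sweep (z : ℂ) : Measure ℂ :=
  if ‖z‖ < 1 then
    circleDensity (Set.Ioc 0 (2 * Real.pi))
      fun θ => (2 * Real.pi)⁻¹ * poissonKernel 0 z (circleMap 0 1 θ)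
  else Measure.dirac z

theorem isProbabilityMeasure_circleDensity {l r : ℝ} (hlr : l ≤ r) {f : ℝ → ℝ}
    (hf : IntervalIntegrable f volume l r) (h0 : ∀ θ ∈ Set.Ioc l r, 0 ≤ f θ)
    (h1 : ∫ θ in l..r, f θ = 1) :
    IsProbabilityMeasure (circleDensity (Set.Ioc l r) f) := by
  have : IsProbabilityMeasure
      ((volume.restrict (Set.Ioc l r)).withDensity fun θ => ENNReal.ofReal (f θ)) := by
    constructor
    rw [withDensity_apply _ MeasurableSet.univ, Measure.restrict_univ,
      ← ofReal_integral_eq_lintegral_ofReal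
        ((intervalIntegrable_iff_integrableOn_Ioc_of_le hlr).1 hf)
        ((ae_restrict_iff' measurableSet_Ioc).2 (ae_of_all _ h0)),
      ← intervalIntegral.integral_of_le hlr, h1, ENNReal.ofReal_one]
  exact Measure.isProbabilityMeasure_map (measurable_circleMap 0 1).aemeasurable

theorem integral_circleDensity {l r : ℝ} (hlr : l ≤ r) {f : ℝ → ℝ} (hf : Measurable f)
    (h0 : ∀ θ ∈ Set.Ioc l r, 0 ≤ f θ) {g : ℂ → ℂ} (hg : Continuous g) :
    ∫ ζ, g ζ ∂circleDensity (Set.Ioc l r) f = ∫ θ in l..r, f θ • g (circleMap 0 1 θ) := by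
  rw [circleDensity, integral_map (measurable_circleMap 0 1).aemeasurable
    hg.aestronglyMeasurable, integral_withDensity_eq_integral_toReal_smul (by fun_prop) (by simp),
    intervalIntegral.integral_of_le hlr]
  refine setIntegral_congr_fun measurableSet_Ioc fun θ hθ => ?_
  simp only [ENNReal.toReal_ofReal (h0 θ hθ)]

theorem measurable_circleDensity {T : Type*} [MeasurableSpace T] {l r : T → ℝ} {f : T → ℝ → ℝ}
    (hl : Measurable l) (hr : Measurable r) (hf : Measurable (Function.uncurry f)) :
    Measurable fun x => circleDensity (Set.Ioc (l x) (r x)) (f x) := by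
  refine (Measure.measurable_map _ (measurable_circleMap 0 1)).comp ?_
  refine Measure.measurable_of_measurable_coe _ fun s hs => ?_
  have hset : MeasurableSet {p : T × ℝ | p.2 ∈ Set.Ioc (l p.1) (r p.1)} :=
    (measurableSet_lt (hl.comp measurable_fst) measurable_snd).inter
      (measurableSet_le measurable_snd (hr.comp measurable_fst))
  have h2 : Measurable fun p : T × ℝ =>
      ({p : T × ℝ | p.2 ∈ Set.Ioc (l p.1) (r p.1)}.indicator
        (fun p => ENNReal.ofReal (f p.1 p.2)) p) :=
    (ENNReal.measurable_ofReal.comp hf).indicator hset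
  have h3 := h2.lintegral_prod_right' (ν := volume.restrict s)
  convert h3 using 2 with x
  rw [← withDensity_indicator measurableSet_Ioc, withDensity_apply _ hs]
  rfl

theorem continuous_poissonKernel_circleMap {z : ℂ} (hz : ‖z‖ < 1) :
    Continuous fun θ => poissonKernel 0 z (circleMap 0 1 θ) := by
  unfold poissonKernel
  refine Continuous.div (by fun_prop) (by fun_prop) fun θ h => ?_
  have : circleMap 0 1 θ = z := by simpa [sub_eq_zero] using h
  have h2 : ‖circleMap 0 1 θ‖ = 1 := by simp
  rw [this] at h2
  linarith

theorem poissonKernel_circleMap_nonneg {z : ℂ} (hz : ‖z‖ < 1) (θ : ℝ) :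
    0 ≤ (2 * Real.pi)⁻¹ * poissonKernel 0 z (circleMap 0 1 θ) := by
  unfold poissonKernel
  have h2 : ‖circleMap 0 1 θ‖ = 1 := by simp
  have h3 : ‖z‖ ^ 2 ≤ 1 := by nlinarith [norm_nonneg z]
  simp only [sub_zero, h2]
  have : 0 ≤ 1 ^ 2 - ‖z‖ ^ 2 := by linarith
  positivity

theorem integral_poissonKernel_pow {z : ℂ} (hz : ‖z‖ < 1) (k : ℕ) :
    ∫ θ in (0 : ℝ)..2 * Real.pi, ((2 * Real.pi)⁻¹ * poissonKernel 0 z (circleMap 0 1 θ)) •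
      (circleMap 0 1 θ) ^ k = z ^ k := by
  have hd : DiffContOnCl ℂ (fun w : ℂ => w ^ k) (Metric.ball 0 1) :=
    (differentiable_id.pow k).diffContOnCl
  have h := hd.circleAverage_poissonKernel_smul (w := z) (by simpa using hz)
  rw [Real.circleAverage_def, ← intervalIntegral.integral_smul] at h
  rw [← h]
  refine intervalIntegral.integral_congr fun θ _ => ?_
  simp only [Pi.smul_apply', smul_smul]

instance isProbabilityMeasure_sweep (z : ℂ) : IsProbabilityMeasure (sweep z) := by
  unfold sweep
  split_ifs with hz
  · refine isProbabilityMeasure_circleDensity (by positivity) ?_ ?_ ?_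
    · exact ((continuous_poissonKernel_circleMap hz).const_mul _).intervalIntegrable _ _
    · exact fun θ _ => poissonKernel_circleMap_nonneg hz θ
    · have h := integral_poissonKernel_pow hz 0
      simp only [pow_zero, Complex.real_smul, mul_one, intervalIntegral.integral_ofReal] at h
      exact_mod_cast h
  · infer_instance

theorem measurable_sweep : Measurable sweep := by
  refine Measurable.ite (measurableSet_lt measurable_norm measurable_const) ?_
    Measure.measurable_dirac
  refine measurable_circleDensity measurable_const measurable_const ?_
  unfold poissonKernel Function.uncurry
  have : Measurable (circleMap 0 1) := measurable_circleMap 0 1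
  fun_prop

theorem integral_sweep_pow (z : ℂ) (k : ℕ) : ∫ ζ, ζ ^ k ∂sweep z = z ^ k := by
  unfold sweep
  split_ifs with h
  · rw [integral_circleDensity (by positivity)
      ((continuous_poissonKernel_circleMap h).const_mul _).measurable
      (fun θ _ => poissonKernel_circleMap_nonneg h θ) (continuous_pow k)]
    exact integral_poissonKernel_pow h k
  · simp

theorem sweep_compl_sphere {z : ℂ} (hz : ‖z‖ ≤ 1) : sweep z (Metric.sphere 0 1)ᶜ = 0 := by
  unfold sweep
  split_ifs with h
  · rw [circleDensity, Measure.map_apply (measurable_circleMap 0 1)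
      Metric.isClosed_sphere.measurableSet.compl]
    have : circleMap 0 1 ⁻¹' (Metric.sphere (0 : ℂ) 1)ᶜ = ∅ := by
      ext θ
      simp
    rw [this, measure_empty]
  · have : ‖z‖ = 1 := le_antisymm hz (not_lt.1 h)
    rw [Measure.dirac_apply' _ Metric.isClosed_sphere.measurableSet.compl]
    simp [this]

/-- The balayage `P(μ)` onto the unit circle of a finite measure `μ` carried by the closed unit
disk: `∫ f dP(μ) = ∫ (∫ f d(sweep z)) dμ(z)`. -/
def balayage (μ : FiniteMeasure ℂ) : FiniteMeasure ℂ :=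
  ⟨(μ : Measure ℂ).bind sweep, ⟨by
    rw [Measure.bind_apply MeasurableSet.univ measurable_sweep.aemeasurable]
    simp⟩⟩

theorem isProbabilityMeasure_balayage (μ : FiniteMeasure ℂ)
    [IsProbabilityMeasure (μ : Measure ℂ)] :
    IsProbabilityMeasure (balayage μ : Measure ℂ) := by
  constructor
  change (μ : Measure ℂ).bind sweep Set.univ = 1
  rw [Measure.bind_apply MeasurableSet.univ measurable_sweep.aemeasurable]
  simp

/-- The balayage is carried by the unit circle. -/
theorem balayage_sphere (μ : FiniteMeasure ℂ)
    (hμ : ∀ᵐ z ∂(μ : Measure ℂ), ‖z‖ ≤ 1) :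
    (balayage μ : Measure ℂ) (Metric.sphere 0 1)ᶜ = 0 := by
  change (μ : Measure ℂ).bind sweep _ = 0
  rw [Measure.bind_apply Metric.isClosed_sphere.measurableSet.compl measurable_sweep.aemeasurable,
    lintegral_congr_ae (hμ.mono fun z hz => sweep_compl_sphere hz), lintegral_zero]

/-- The balayage has the same moments of non-negative order as the measure itself; among the
measures on the unit circle this characterizes it. -/
theorem integral_balayage_pow (μ : FiniteMeasure ℂ)
    (hμ : ∀ᵐ z ∂(μ : Measure ℂ), ‖z‖ ≤ 1) (k : ℕ) :
    ∫ ζ, ζ ^ k ∂(balayage μ : Measure ℂ) = ∫ z, z ^ k ∂(μ : Measure ℂ) := by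
  let κ : ProbabilityTheory.Kernel ℂ ℂ := ⟨sweep, measurable_sweep⟩
  have hb : (balayage μ : Measure ℂ)
      = (κ.comp (ProbabilityTheory.Kernel.const Unit (μ : Measure ℂ))) () := by
    rw [ProbabilityTheory.Kernel.comp_apply, ProbabilityTheory.Kernel.const_apply]
    rfl
  have hint : Integrable (fun ζ : ℂ => ζ ^ k) (balayage μ : Measure ℂ) := by
    refine Integrable.of_bound (continuous_pow k).aestronglyMeasurable 1 ?_
    have : ∀ᵐ ζ ∂(balayage μ : Measure ℂ), ζ ∈ Metric.sphere (0 : ℂ) 1 :=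
      balayage_sphere μ hμ
    filter_upwards [this] with ζ hζ
    simp [mem_sphere_zero_iff_norm.1 hζ]
  rw [hb] at hint ⊢
  rw [ProbabilityTheory.Kernel.integral_comp hint]
  exact integral_congr_ae (ae_of_all _ fun z => integral_sweep_pow z k)

/-- The angle `θ_a = 2 arcsin a`. -/
def arcAngle (a : ℝ) : ℝ := 2 * Real.arcsin a

/-- The density (in the angle) of the equilibrium measure of the arc
`{exp (i θ) : θ_a ≤ θ ≤ 2π - θ_a}`. -/
def arcDensity (a θ : ℝ) : ℝ :=
  (2 * Real.pi)⁻¹ *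
    (Real.sin (θ / 2) / √(Real.cos (arcAngle a / 2) ^ 2 - Real.cos (θ / 2) ^ 2))

/-- The equilibrium measure `ν_a` of the arc `{exp (i θ) : θ_a ≤ θ ≤ 2π - θ_a}` for `0 ≤ a ≤ 1`;
for `a = 1` it is the unit mass at `-1`. (Other values of `a` play no role.) -/
def arcMeasure (a : ℝ) : Measure ℂ :=
  if 0 ≤ a ∧ a < 1 then
    circleDensity (Set.Ioc (arcAngle a) (2 * Real.pi - arcAngle a)) (arcDensity a)
  else Measure.dirac (-1)

theorem measurable_arcMeasure : Measurable arcMeasure := by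
  refine Measurable.ite measurableSet_Ico ?_ measurable_const
  have h : Measurable arcAngle := Real.measurable_arcsin.const_mul 2
  refine measurable_circleDensity h (measurable_const.sub h) ?_
  unfold arcDensity Function.uncurry
  fun_prop

instance isProbabilityMeasure_arcMeasure (a : ℝ) : IsProbabilityMeasure (arcMeasure a) := by
  unfold arcMeasure
  split_ifs with ha
  swap
  · infer_instance
  obtain ⟨h0, h1⟩ := ha
  have hpi := Real.pi_pos
  have hA0 : 0 ≤ Real.arcsin a := Real.arcsin_nonneg.2 h0
  have hA1 : Real.arcsin a < Real.pi / 2 := Real.arcsin_lt_pi_div_two.2 h1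
  have hle : arcAngle a ≤ 2 * Real.pi - arcAngle a := by unfold arcAngle; linarith
  set c := Real.cos (arcAngle a / 2) with hc
  have hcA : arcAngle a / 2 = Real.arcsin a := by unfold arcAngle; ring
  have hcpos : 0 < c := by
    rw [hc, hcA]
    exact Real.cos_pos_of_mem_Ioo ⟨by linarith, hA1⟩
  have hsin : ∀ θ ∈ Set.Ioc (arcAngle a) (2 * Real.pi - arcAngle a), 0 ≤ Real.sin (θ / 2) := by
    intro θ hθ
    have h3 := hθ.1
    have h4 := hθ.2
    unfold arcAngle at h3 h4
    exact Real.sin_nonneg_of_nonneg_of_le_pi (by linarith) (by linarith)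
  have hpos : ∀ θ ∈ Set.Ioc (arcAngle a) (2 * Real.pi - arcAngle a), 0 ≤ arcDensity a θ := by
    intro θ hθ
    have := hsin θ hθ
    unfold arcDensity
    positivity
  let F : ℝ → ℝ := fun θ => -(Real.pi)⁻¹ * Real.arcsin (Real.cos (θ / 2) / c)
  have hcont : Continuous F := by
    have := Real.continuous_arcsin
    fun_prop
  have hder : ∀ θ ∈ Set.Ioo (arcAngle a) (2 * Real.pi - arcAngle a),
      HasDerivAt F (arcDensity a θ) θ := by
    intro θ hθ
    have h3 := hθ.1
    have h4 := hθ.2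
    unfold arcAngle at h3 h4
    have hlt : Real.cos (θ / 2) < c := by
      rw [hc, hcA]
      exact Real.cos_lt_cos_of_nonneg_of_le_pi hA0 (by linarith) (by linarith)
    have hgt : -c < Real.cos (θ / 2) := by
      rw [hc, hcA, ← Real.cos_pi_sub]
      exact Real.cos_lt_cos_of_nonneg_of_le_pi (by linarith) (by linarith) (by linarith)
    have hu1 : Real.cos (θ / 2) / c < 1 := by rwa [div_lt_one hcpos]
    have hu2 : -1 < Real.cos (θ / 2) / c := by rw [lt_div_iff₀ hcpos]; linarith
    have hg : HasDerivAt (fun θ => Real.cos (θ / 2) / c) (-Real.sin (θ / 2) * (1 / 2) / c) θ :=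
      (((hasDerivAt_id θ).div_const 2).cos).div_const c
    have hF := ((Real.hasDerivAt_arcsin hu2.ne' hu1.ne).comp θ hg).const_mul (-(Real.pi)⁻¹)
    refine hF.congr_deriv ?_
    have hsq : √(1 - (Real.cos (θ / 2) / c) ^ 2) = √(c ^ 2 - Real.cos (θ / 2) ^ 2) / c := by
      rw [eq_div_iff hcpos.ne', ← Real.sqrt_sq hcpos.le, Real.sqrt_sq hcpos.le,
        ← Real.sqrt_sq hcpos.le, ← Real.sqrt_mul' _ (sq_nonneg _), Real.sqrt_sq hcpos.le]
      congr 1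
      field_simp
    have hroot : 0 < √(c ^ 2 - Real.cos (θ / 2) ^ 2) := by
      apply Real.sqrt_pos.2
      nlinarith
    rw [hsq, arcDensity, ← hc]
    field_simp
  have hint : IntervalIntegrable (arcDensity a) volume (arcAngle a)
      (2 * Real.pi - arcAngle a) := by
    rw [intervalIntegrable_iff_integrableOn_Ioc_of_le hle]
    exact intervalIntegral.integrableOn_deriv_of_nonneg hcont.continuousOn hder
      fun θ hθ => hpos θ (Set.Ioo_subset_Ioc_self hθ)
  refine isProbabilityMeasure_circleDensity hle hint hpos ?_
  rw [intervalIntegral.integral_eq_sub_of_hasDerivAt_of_le hle hcont.continuousOn hder hint]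
  have e1 : Real.cos ((2 * Real.pi - arcAngle a) / 2) = -c := by
    rw [show (2 * Real.pi - arcAngle a) / 2 = Real.pi - arcAngle a / 2 by ring,
      Real.cos_pi_sub]
  simp only [F, e1, ← hc, neg_div, div_self hcpos.ne', Real.arcsin_neg, Real.arcsin_one]
  field_simp
  norm_num

/-- The average `(1 / t) ∫_0^t ν_{|α(s)|} ds` of the equilibrium measures, that is, the measure
`B ↦ (1 / t) ∫_0^t ν_{|α(s)|}(B) ds` (for `t > 0` and `α` measurable on `[0, t]`). -/
def averageArcMeasure (t : ℝ) (α : ℝ → ℂ) : FiniteMeasure ℂ :=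
  ⟨(ENNReal.ofReal t)⁻¹ •
      (volume.restrict (Set.Icc 0 t)).bind fun s => arcMeasure ‖α s‖, ⟨by
    rcases le_or_gt t 0 with ht | ht
    · have : (volume : Measure ℝ).restrict (Set.Icc 0 t) = 0 := by
        rw [Measure.restrict_eq_zero, Real.volume_Icc]
        simpa using ht
      simp [this]
    · refine ENNReal.mul_lt_top (by simpa using ht) ?_
      refine (Measure.bind_apply_le _ MeasurableSet.univ).trans_lt ?_
      simp⟩⟩

theorem averageArcMeasure_apply {t : ℝ} {α : ℝ → ℂ}
    (hα : AEMeasurable α (volume.restrict (Set.Icc 0 t))) {B : Set ℂ} (hB : MeasurableSet B) :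
    (averageArcMeasure t α : Measure ℂ) B
      = (ENNReal.ofReal t)⁻¹ * ∫⁻ s in Set.Icc 0 t, arcMeasure ‖α s‖ B := by
  have h : AEMeasurable (fun s => arcMeasure ‖α s‖) (volume.restrict (Set.Icc 0 t)) :=
    measurable_arcMeasure.comp_aemeasurable hα.norm
  rw [← Measure.bind_apply hB h]
  rfl

theorem isProbabilityMeasure_averageArcMeasure {t : ℝ} (ht : 0 < t) {α : ℝ → ℂ}
    (hα : AEMeasurable α (volume.restrict (Set.Icc 0 t))) :
    IsProbabilityMeasure (averageArcMeasure t α : Measure ℂ) := by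
  constructor
  rw [averageArcMeasure_apply hα MeasurableSet.univ]
  simpa using ENNReal.inv_mul_cancel (by simpa using ht) (by simp)

/-- `lim_{n/N → t} X n N = L`: the limit along all pairs of sequences `n_j, N_j → ∞` with
`n_j / N_j → t`. -/
def RatioLimit {E : Type*} [TopologicalSpace E] (X : ℕ → ℕ → E) (t : ℝ) (L : E) : Prop :=
  ∀ n N : ℕ → ℕ, Tendsto n atTop atTop → Tendsto N atTop atTop →
    Tendsto (fun j => (n j : ℝ) / (N j : ℝ)) atTop (𝓝 t) →
    Tendsto (fun j => X (n j) (N j)) atTop (𝓝 L)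

end

end VaryingOPUC

open scoped ComplexConjugate

namespace VaryingOPUC

/-! ### The Szegő recurrence and the zeros -/

/-! Since the balayage keeps the moments of non-negative order, and on the circle the negative ones
are their conjugates, it is enough to find the limits of the moments of the zero-counting measures.
These moments are Fourier coefficients of the logarithmic potential `∫ log |1 - z ζ̄| dν(ζ)` on the
circle `|z| = 1/4`, so everything reduces to convergence of potentials at small `z ≠ 0`.

For `ν_{n,N}` the potential is `n⁻¹ log |Φ*_n(z)|`. With `b_n = Φ_n / Φ*_n` the Szegő recurrence
reads `Φ*_{n+1} = Φ*_n (1 - α_n z b_n)` and `b_{n+1} = (z b_n - ᾱ_n) / (1 - α_n z b_n)`, so the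
potential is the mean of the numbers `log |1 - α_m z b_m|`, `m < n`. The map sending `b_n` to
`b_{n+1}` contracts the closed unit disk uniformly in the coefficient when `|z| ≤ 1/4`. Hence, as
`m/N → s`, the iterate `b_m` forgets its past and tends to the fixed point `b` of the map with
coefficient `α(s)` (`ratioLimit_schurIterate`), and the mean, a Riemann sum, tends to `t⁻¹ ∫ log |1
- α(s) z b| ds` (`ratioLimit_average`).

The number `w = 1 - α z b` is the root near `1` of `w² - (1 + z) w + z (1 - |α|²) = 0`. A direct
computation shows that `log |w|` is the potential of the arc measure `ν_{|α|}`
(`integral_logKernel_arcMeasure`), so the limit is the potential of the averaged measure. Density of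
the trigonometric polynomials turns convergence of moments into weak convergence. -/

theorem eval_reversed_opuc (a : ℕ → ℂ) (n : ℕ) {z : ℂ} (hz : z ≠ 0) :
    (reversed n (opuc a n)).eval z = z ^ n * conj ((opuc a n).eval (1 / conj z)) :=
  eval_reversed n _ (opuc_monic_natDegree a n).2.le z hz

theorem eval_reversed_opuc_succ (a : ℕ → ℂ) (n : ℕ) {z : ℂ} (hz : z ≠ 0) :
    (reversed (n + 1) (opuc a (n + 1))).eval z
      = (reversed n (opuc a n)).eval z - a n * z * (opuc a n).eval z := by
  have hz' : 1 / conj z ≠ 0 := by simpa using hz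
  have h := eval_reversed_opuc a n hz'
  rw [map_div₀, map_one, Complex.conj_conj, one_div_one_div] at h
  rw [eval_reversed_opuc a (n + 1) hz, eval_reversed_opuc a n hz, opuc, eval_sub, eval_mul,
    eval_mul, eval_X, eval_C, h]
  simp only [map_sub, map_mul, map_div₀, map_one, Complex.conj_conj, map_pow]
  rw [div_pow, one_pow, pow_succ]
  field_simp

/-- The values of the orthonormal pair in the closed disk: `|Φ_n| ≤ |Φ_n*|` and `Φ_n* ≠ 0`. -/
theorem reversed_opuc_ne_zero_and_norm_le {a : ℕ → ℂ} (ha : ∀ k, ‖a k‖ < 1) (n : ℕ) {z : ℂ}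
    (hz : z ≠ 0) (hz1 : ‖z‖ ≤ 1) :
    (reversed n (opuc a n)).eval z ≠ 0 ∧
      ‖(opuc a n).eval z‖ ≤ ‖(reversed n (opuc a n)).eval z‖ := by
  induction n with
  | zero =>
    rw [eval_reversed_opuc _ _ hz]
    simp [opuc]
  | succ n ih =>
    obtain ⟨h0, hle⟩ := ih
    rw [eval_reversed_opuc_succ a n hz, opuc, eval_sub, eval_mul, eval_mul, eval_X, eval_C]
    set Q := (reversed n (opuc a n)).eval z
    set P := (opuc a n).eval z
    have hQ : 0 < ‖Q‖ := norm_pos_iff.2 h0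
    have hzP : ‖z * P‖ ≤ ‖Q‖ := by
      rw [norm_mul]
      nlinarith [norm_nonneg P, norm_nonneg z]
    constructor
    · intro h
      have h1 : ‖Q‖ = ‖a n‖ * ‖z * P‖ := by
        rw [← norm_mul, ← mul_assoc, sub_eq_zero.1 h]
      nlinarith [norm_nonneg (a n), ha n]
    -- A Szegő step multiplies the indefinite form `|Q|² - |R|²`, `R = zP`, by `1 - |α|²`, so its
    -- sign is preserved.
    · have key : ‖z * P - conj (a n) * Q‖ ^ 2 + (1 - ‖a n‖ ^ 2) * (‖Q‖ ^ 2 - ‖z * P‖ ^ 2)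
          = ‖Q - a n * z * P‖ ^ 2 := by
        rw [mul_assoc (a n)]
        generalize z * P = R
        simp only [← Complex.normSq_eq_norm_sq, Complex.normSq_apply, Complex.sub_re,
          Complex.sub_im, Complex.mul_re, Complex.mul_im, Complex.conj_re, Complex.conj_im]
        ring
      have h2 : 0 ≤ (1 - ‖a n‖ ^ 2) * (‖Q‖ ^ 2 - ‖z * P‖ ^ 2) := by
        refine mul_nonneg ?_ ?_
        · nlinarith [norm_nonneg (a n), ha n]
        · nlinarith [norm_nonneg (z * P)]
      exact le_of_sq_le_sq (by linarith) (norm_nonneg _)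

/-- A zero outside the open disk would reflect in the circle to a nonzero point of the closed disk
where `Φ*_n` vanishes. -/
theorem norm_lt_one_of_mem_roots_opuc {a : ℕ → ℂ} (ha : ∀ k, ‖a k‖ < 1) (n : ℕ) {z : ℂ}
    (hz : z ∈ (opuc a n).roots) : ‖z‖ < 1 := by
  by_contra! h
  have hz0 : z ≠ 0 := by
    rintro rfl
    simp at h
    linarith
  have hw : 1 / conj z ≠ 0 := by simpa using hz0
  have hw1 : ‖1 / conj z‖ ≤ 1 := by
    rw [norm_div, norm_one, Complex.norm_conj]
    exact div_le_one_of_le₀ h (norm_nonneg z)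
  refine (reversed_opuc_ne_zero_and_norm_le ha n hw hw1).1 ?_
  rw [eval_reversed_opuc a n hw, map_div₀, map_one, Complex.conj_conj, one_div_one_div,
    ((mem_roots').1 hz).2]
  simp

/-! ### Logarithmic potentials of the zero-counting measures -/

theorem log_norm_multiset_prod (s : Multiset ℂ) (h : ∀ z ∈ s, z ≠ 0) :
    Real.log ‖s.prod‖ = (s.map fun z => Real.log ‖z‖).sum := by
  induction s using Multiset.induction_on with
  | empty => simp
  | cons z s ih =>
    have h1 : s.prod ≠ 0 := Multiset.prod_ne_zero fun h0 =>
      h 0 (Multiset.mem_cons_of_mem h0) rfl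
    rw [Multiset.prod_cons, norm_mul, Real.log_mul (norm_ne_zero_iff.2 (h z (by simp)))
      (norm_ne_zero_iff.2 h1), Multiset.map_cons, Multiset.sum_cons,
      ih fun w hw => h w (Multiset.mem_cons_of_mem hw)]

/-- The logarithmic test function `log |1 - z ζ̄|`. -/
noncomputable def logKernel (z ζ : ℂ) : ℝ := Real.log ‖1 - z * conj ζ‖

theorem one_sub_mul_conj_ne_zero {z ζ : ℂ} (hz : ‖z‖ < 1) (hζ : ‖ζ‖ ≤ 1) :
    1 - z * conj ζ ≠ 0 := by
  intro h
  have h1 : ‖z * conj ζ‖ = 1 := by rw [← sub_eq_zero.1 h, norm_one]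
  rw [norm_mul, Complex.norm_conj] at h1
  nlinarith [norm_nonneg z, norm_nonneg ζ]

/-- The `n` factors `z` are distributed over the `n` roots: `z · conj (1 / z̄ - ζ) = 1 - z ζ̄`. -/
theorem eval_reversed_opuc_eq_prod (a : ℕ → ℂ) (n : ℕ) {z : ℂ} (hz : z ≠ 0) :
    (reversed n (opuc a n)).eval z
      = ((opuc a n).roots.map fun ζ => 1 - z * conj ζ).prod := by
  obtain ⟨hm, hd⟩ := opuc_monic_natDegree a n
  have hs : (opuc a n).Splits := IsAlgClosed.splits _
  have hcard : (opuc a n).roots.card = n := by rw [splits_iff_card_roots.1 hs, hd]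
  have he : (opuc a n).eval (1 / conj z)
      = ((opuc a n).roots.map fun ζ => 1 / conj z - ζ).prod := by
    conv_lhs => rw [hs.eq_prod_roots_of_monic hm]
    rw [eval_multiset_prod, Multiset.map_map]
    simp
  rw [eval_reversed_opuc a n hz, he, map_multiset_prod, Multiset.map_map]
  nth_rw 1 [← hcard]
  rw [← Multiset.prod_replicate, ← Multiset.map_const', ← Multiset.prod_map_mul]
  congr 1
  refine Multiset.map_congr rfl fun ζ _ => ?_
  simp
  field_simp

theorem log_norm_eval_reversed_opuc {a : ℕ → ℂ} (ha : ∀ k, ‖a k‖ < 1) (n : ℕ) {z : ℂ}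
    (hz : z ≠ 0) (hz1 : ‖z‖ < 1) :
    Real.log ‖(reversed n (opuc a n)).eval z‖ = ((opuc a n).roots.map (logKernel z)).sum := by
  rw [eval_reversed_opuc_eq_prod a n hz, log_norm_multiset_prod, Multiset.map_map]
  · rfl
  · intro w hw
    obtain ⟨ζ, hζ, rfl⟩ := Multiset.mem_map.1 hw
    exact one_sub_mul_conj_ne_zero hz1 (norm_lt_one_of_mem_roots_opuc ha n hζ).le

theorem integrable_sum_dirac (s : Multiset ℂ) (f : ℂ → ℝ) :
    Integrable f (s.map (Measure.dirac : ℂ → Measure ℂ)).sum := by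
  induction s using Multiset.induction_on with
  | empty => simp
  | cons z s ih =>
    rw [Multiset.map_cons, Multiset.sum_cons, integrable_add_measure]
    exact ⟨integrable_dirac (by simp), ih⟩

theorem integral_sum_dirac (s : Multiset ℂ) (f : ℂ → ℝ) :
    ∫ ζ, f ζ ∂(s.map (Measure.dirac : ℂ → Measure ℂ)).sum = (s.map f).sum := by
  induction s using Multiset.induction_on with
  | empty => simp
  | cons z s ih =>
    rw [Multiset.map_cons, Multiset.sum_cons, integral_add_measure (integrable_dirac (by simp))
      (integrable_sum_dirac s f), ih, integral_dirac, Multiset.map_cons, Multiset.sum_cons]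

theorem integral_logKernel_zeroMeasure {a : ℕ → ℂ} (ha : ∀ k, ‖a k‖ < 1) (n : ℕ) {z : ℂ}
    (hz : z ≠ 0) (hz1 : ‖z‖ < 1) :
    ∫ ζ, logKernel z ζ ∂(zeroMeasure a n : Measure ℂ)
      = (n : ℝ)⁻¹ * Real.log ‖(reversed n (opuc a n)).eval z‖ := by
  change ∫ ζ, logKernel z ζ ∂(zeroMeasureOf n (opuc a n)) = _
  rw [zeroMeasureOf, integral_smul_measure, integral_sum_dirac,
    log_norm_eval_reversed_opuc ha n hz hz1]
  simp

theorem ae_sum_dirac (s : Multiset ℂ) {p : ℂ → Prop} (h : ∀ z ∈ s, p z) :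
    ∀ᵐ ζ ∂(s.map (Measure.dirac : ℂ → Measure ℂ)).sum, p ζ := by
  induction s using Multiset.induction_on with
  | empty => simp
  | cons z s ih =>
    rw [Multiset.map_cons, Multiset.sum_cons, ae_add_measure_iff]
    refine ⟨?_, ih fun w hw => h w (Multiset.mem_cons_of_mem hw)⟩
    rw [ae_dirac_eq]
    exact h z (by simp)

theorem zeroMeasure_ae_norm_le {a : ℕ → ℂ} (ha : ∀ k, ‖a k‖ < 1) (n : ℕ) :
    ∀ᵐ ζ ∂(zeroMeasure a n : Measure ℂ), ‖ζ‖ ≤ 1 := by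
  change ∀ᵐ ζ ∂(zeroMeasureOf n (opuc a n)), _
  exact Measure.ae_smul_measure
    (ae_sum_dirac _ fun z hz => (norm_lt_one_of_mem_roots_opuc ha n hz).le) _

/-! ### The Schur iterates -/

/-- One step `b ↦ (z b - ᾱ) / (1 - α z b)` of the Schur recursion. -/
noncomputable def schurStep (z α b : ℂ) : ℂ := (z * b - conj α) / (1 - α * z * b)

/-- The inverse Schur iterates `Φ_n / Φ_n*` at the point `z`. -/
noncomputable def schurIterate (a : ℕ → ℂ) (z : ℂ) (n : ℕ) : ℂ :=
  (opuc a n).eval z / (reversed n (opuc a n)).eval z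

section

variable {a : ℕ → ℂ} (ha : ∀ k, ‖a k‖ < 1) {z : ℂ} (hz : z ≠ 0) (hz1 : ‖z‖ ≤ 1)
include ha hz hz1

theorem norm_schurIterate_le (n : ℕ) : ‖schurIterate a z n‖ ≤ 1 := by
  obtain ⟨_, h1⟩ := reversed_opuc_ne_zero_and_norm_le ha n hz hz1
  rw [schurIterate, norm_div]
  exact div_le_one_of_le₀ h1 (norm_nonneg _)

theorem eval_reversed_opuc_succ_eq_mul (n : ℕ) :
    (reversed (n + 1) (opuc a (n + 1))).eval z
      = (reversed n (opuc a n)).eval z * (1 - a n * z * schurIterate a z n) := by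
  obtain ⟨h0, _⟩ := reversed_opuc_ne_zero_and_norm_le ha n hz hz1
  rw [eval_reversed_opuc_succ a n hz, schurIterate]
  field_simp

theorem schurIterate_succ (n : ℕ) :
    schurIterate a z (n + 1) = schurStep z (a n) (schurIterate a z n) := by
  obtain ⟨h0, _⟩ := reversed_opuc_ne_zero_and_norm_le ha n hz hz1
  rw [schurStep, schurIterate, eval_reversed_opuc_succ a n hz, opuc, eval_sub, eval_mul, eval_mul,
    eval_X, eval_C, schurIterate]
  field_simp

/-- The product for `Φ*_n` telescopes from `Φ*_0 = 1`. Each summand depends only on the coefficient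
and the iterate at time `m`, both of which have limits as `m/N → s`. -/
theorem log_norm_eval_reversed_opuc_eq_sum (n : ℕ) :
    Real.log ‖(reversed n (opuc a n)).eval z‖
      = ∑ m ∈ Finset.range n, Real.log ‖1 - a m * z * schurIterate a z m‖ := by
  induction n with
  | zero =>
    rw [eval_reversed_opuc _ _ hz]
    simp [opuc]
  | succ n ih =>
    obtain ⟨h0, _⟩ := reversed_opuc_ne_zero_and_norm_le ha n hz hz1
    obtain ⟨h1, _⟩ := reversed_opuc_ne_zero_and_norm_le ha (n + 1) hz hz1
    rw [eval_reversed_opuc_succ_eq_mul ha hz hz1] at h1 ⊢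
    rw [norm_mul, Real.log_mul (norm_ne_zero_iff.2 h0) (norm_ne_zero_iff.2 (right_ne_zero_of_mul h1)),
      ih, Finset.sum_range_succ]

end

/-! ### Estimates for the Schur step when `|z| ≤ 1/4` -/

section

variable {z α b c : ℂ} (hz : ‖z‖ ≤ 1 / 4) (hα : ‖α‖ ≤ 1) (hb : ‖b‖ ≤ 1)
include hz hα hb

theorem norm_mul_mul_le : ‖α * z * b‖ ≤ 1 / 4 := by
  rw [norm_mul, norm_mul]
  have h1 := mul_le_mul hα hz (norm_nonneg z) zero_le_one
  nlinarith [mul_le_mul h1 hb (norm_nonneg b) (by norm_num), norm_nonneg z, norm_nonneg b]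

theorem norm_one_sub_mul_mul_ge : 3 / 4 ≤ ‖1 - α * z * b‖ := by
  have h := norm_sub_norm_le 1 (α * z * b)
  have := norm_mul_mul_le hz hα hb
  rw [norm_one] at h
  linarith

theorem norm_one_sub_mul_mul_le : ‖1 - α * z * b‖ ≤ 5 / 4 := by
  have h := norm_sub_le 1 (α * z * b)
  have := norm_mul_mul_le hz hα hb
  rw [norm_one] at h
  linarith

theorem one_sub_mul_mul_ne_zero : 1 - α * z * b ≠ 0 := by
  rw [← norm_pos_iff]
  linarith [norm_one_sub_mul_mul_ge hz hα hb]

theorem abs_log_norm_one_sub_mul_mul_le : |Real.log ‖1 - α * z * b‖| ≤ 1 := by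
  have h1 := norm_one_sub_mul_mul_ge hz hα hb
  have h2 := norm_one_sub_mul_mul_le hz hα hb
  have h0 : 0 < ‖1 - α * z * b‖ := by linarith
  rw [abs_le]
  constructor
  · have h3 := Real.one_sub_inv_le_log_of_pos h0
    have : ‖1 - α * z * b‖⁻¹ ≤ (3 / 4)⁻¹ := inv_anti₀ (by norm_num) h1
    norm_num at this
    linarith
  · linarith [Real.log_le_sub_one_of_pos h0]

/-- The difference has numerator `z (1 - |α|²) (b - c)`, with `|z (1 - |α|²)| ≤ 1/4`, and a
denominator of modulus at least `(3/4)²`; hence the constant `4/9`. It does not degenerate as `|α| →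
1`. -/
theorem dist_schurStep_le (hc : ‖c‖ ≤ 1) :
    dist (schurStep z α b) (schurStep z α c) ≤ 4 / 9 * dist b c := by
  have hb0 := one_sub_mul_mul_ne_zero hz hα hb
  have hc0 := one_sub_mul_mul_ne_zero hz hα hc
  have hb1 := norm_one_sub_mul_mul_ge hz hα hb
  have hc1 := norm_one_sub_mul_mul_ge hz hα hc
  have e : schurStep z α b - schurStep z α c
      = z * (1 - α * conj α) * (b - c) / ((1 - α * z * b) * (1 - α * z * c)) := by
    rw [schurStep, schurStep, div_sub_div _ _ hb0 hc0]
    congr 1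
    ring
  have h1 : ‖1 - α * conj α‖ ≤ 1 := by
    rw [Complex.mul_conj, Complex.normSq_eq_norm_sq, ← Complex.ofReal_one, ← Complex.ofReal_sub,
      Complex.norm_real, Real.norm_eq_abs, abs_le]
    constructor <;> nlinarith [norm_nonneg α]
  rw [dist_eq_norm, dist_eq_norm, e, norm_div, norm_mul, norm_mul, norm_mul,
    div_le_iff₀ (by positivity)]
  have h2 : ‖z‖ * ‖1 - α * conj α‖ ≤ 1 / 4 := by
    nlinarith [norm_nonneg z, norm_nonneg (1 - α * conj α)]
  have h3 : 9 / 16 ≤ ‖1 - α * z * b‖ * ‖1 - α * z * c‖ := by nlinarith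
  nlinarith [norm_nonneg (b - c), mul_le_mul_of_nonneg_right h2 (norm_nonneg (b - c)),
    mul_le_mul_of_nonneg_left h3 (norm_nonneg (b - c))]

/-- The step is `R ↦ (R - ᾱ) / (1 - α R)` at `R = z b`, for `|α| < 1` a Möbius automorphism of the
disk; the identity `key` also covers `|α| = 1`. -/
theorem norm_schurStep_le : ‖schurStep z α b‖ ≤ 1 := by
  have hb0 := one_sub_mul_mul_ne_zero hz hα hb
  rw [schurStep, norm_div]
  refine div_le_one_of_le₀ (le_of_sq_le_sq ?_ (norm_nonneg _)) (norm_nonneg _)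
  have key : ‖z * b - conj α‖ ^ 2 + (1 - ‖α‖ ^ 2) * (1 - ‖z * b‖ ^ 2)
      = ‖1 - α * z * b‖ ^ 2 := by
    rw [mul_assoc α]
    generalize z * b = R
    simp only [← Complex.normSq_eq_norm_sq, Complex.normSq_apply, Complex.sub_re,
      Complex.sub_im, Complex.mul_re, Complex.mul_im, Complex.conj_re, Complex.conj_im,
      Complex.one_re, Complex.one_im]
    ring
  have h1 : ‖z * b‖ ≤ 1 := by
    rw [norm_mul]
    nlinarith [norm_nonneg z, norm_nonneg b]
  have : 0 ≤ (1 - ‖α‖ ^ 2) * (1 - ‖z * b‖ ^ 2) := by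
    refine mul_nonneg ?_ ?_
    · nlinarith [norm_nonneg α]
    · nlinarith [norm_nonneg (z * b)]
  linarith

end

theorem exists_schurStep_eq_self {z α : ℂ} (hz : ‖z‖ ≤ 1 / 4) (hα : ‖α‖ ≤ 1) :
    ∃ b, ‖b‖ ≤ 1 ∧ schurStep z α b = b := by
  have hmaps : Set.MapsTo (schurStep z α) (Metric.closedBall 0 1) (Metric.closedBall 0 1) := by
    intro b hb
    rw [mem_closedBall_zero_iff] at hb ⊢
    exact norm_schurStep_le hz hα hb
  have hK : ContractingWith (4 / 9) (hmaps.restrict (schurStep z α) _ _) := by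
    refine ⟨by rw [div_lt_one] <;> norm_num, LipschitzWith.of_dist_le_mul fun b c => ?_⟩
    have := dist_schurStep_le hz hα (mem_closedBall_zero_iff.1 b.2) (mem_closedBall_zero_iff.1 c.2)
    simpa [Subtype.dist_eq] using this
  obtain ⟨b, hb, hfix, -⟩ := hK.exists_fixedPoint' Metric.isClosed_closedBall.isComplete hmaps
    (Metric.mem_closedBall_self zero_le_one) (edist_ne_top _ _)
  exact ⟨b, mem_closedBall_zero_iff.1 hb, hfix⟩

/-- Put `w = 1 - α z b`. Multiplying the fixed-point equation `z b - ᾱ = b w` by `α z` and using `α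
z b = 1 - w` eliminates `b`, and only `|α|` remains. -/
theorem schurStep_fixed_quadratic {z α b : ℂ} (hz : ‖z‖ ≤ 1 / 4) (hα : ‖α‖ ≤ 1) (hb : ‖b‖ ≤ 1)
    (h : schurStep z α b = b) :
    (1 - α * z * b) ^ 2 - (1 + z) * (1 - α * z * b) + z * (1 - (‖α‖ : ℂ) ^ 2) = 0 := by
  rw [schurStep, div_eq_iff (one_sub_mul_mul_ne_zero hz hα hb)] at h
  have hn : α * conj α = (‖α‖ : ℂ) ^ 2 := by
    rw [Complex.mul_conj, Complex.normSq_eq_norm_sq]; push_cast; rfl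
  rw [← hn]
  linear_combination (α * z) * h

/-! ### The logarithmic potential of the equilibrium measure of an arc -/

/-- As `2u` runs over a full period this is the mean over the unit circle of `log |ζ + B̄|`, which
vanishes because `-B̄` lies inside the disk. -/
theorem integral_log_norm_one_add_mul_exp {B : ℂ} (hB : ‖B‖ < 1) :
    ∫ u in -(Real.pi / 2)..Real.pi / 2, Real.log ‖1 + B * Complex.exp (2 * u * Complex.I)‖ = 0 := by
  have hB' : ‖-conj B‖ < 1 := by simpa using hB
  have h := circleAverage_log_norm_sub_const₀ hB'
  set f : ℝ → ℝ := fun θ => Real.log ‖circleMap 0 1 θ - -conj B‖ with hf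
  have hper : Function.Periodic f (2 * Real.pi) := fun θ => by
    simp only [hf, periodic_circleMap 0 1 θ]
  have h0 : ∫ θ in (0 : ℝ)..2 * Real.pi, f θ = 0 := by
    rw [Real.circleAverage_def, smul_eq_zero] at h
    exact h.resolve_left (by positivity)
  have h1 : ∫ θ in -Real.pi..Real.pi, f θ = 0 := by
    have := hper.intervalIntegral_add_eq (-Real.pi) 0
    rw [zero_add, h0, show -Real.pi + 2 * Real.pi = Real.pi by ring] at this
    exact this
  have h2 : ∀ u : ℝ, Real.log ‖1 + B * Complex.exp (2 * u * Complex.I)‖ = f (2 * u) := by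
    intro u
    have e1 : circleMap 0 1 (2 * u) = Complex.exp (2 * u * Complex.I) := by
      simp [circleMap]
    have e2 : conj (Complex.exp (2 * u * Complex.I)) * Complex.exp (2 * u * Complex.I) = 1 := by
      rw [← Complex.exp_conj, ← Complex.exp_add]
      simp only [map_mul, map_ofNat, Complex.conj_ofReal, Complex.conj_I]
      simp
    have e3 : 1 + B * Complex.exp (2 * u * Complex.I)
        = Complex.exp (2 * u * Complex.I) * conj (Complex.exp (2 * u * Complex.I) + conj B) := by
      rw [map_add, Complex.conj_conj]
      linear_combination -e2
    have e4 : ‖Complex.exp (2 * u * Complex.I)‖ = 1 := by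
      rw [← e1]; simp
    simp only [hf]
    rw [e3, norm_mul, e4, one_mul, Complex.norm_conj, e1, sub_neg_eq_add]
  simp_rw [h2]
  rw [intervalIntegral.integral_comp_mul_left f two_ne_zero,
    show 2 * -(Real.pi / 2) = -Real.pi by ring, show 2 * (Real.pi / 2) = Real.pi by ring, h1,
    smul_zero]

theorem continuous_log_norm_one_add_mul_exp {B : ℂ} (hB : ‖B‖ < 1) :
    Continuous fun u : ℝ => Real.log ‖1 + B * Complex.exp (2 * u * Complex.I)‖ := by
  refine Continuous.log (by fun_prop) fun u h => ?_
  rw [norm_eq_zero, add_eq_zero_iff_eq_neg] at h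
  have h1 : ‖B * Complex.exp (2 * u * Complex.I)‖ = 1 := by rw [← norm_neg, ← h, norm_one]
  have : ‖Complex.exp (2 * u * Complex.I)‖ = 1 := by
    have := Complex.norm_exp_ofReal_mul_I (2 * u)
    push_cast at this
    exact this
  rw [norm_mul, this, mul_one] at h1
  linarith

/-- The factorization of `|e^{iθ} - z|²`-type quadratics behind the potential of the arc. -/
theorem integral_log_norm_quadratic {r : ℝ} (hr0 : 0 ≤ r) (hr1 : r ≤ 1) {z w : ℂ}
    (hz : ‖z‖ ≤ 1 / 4) (hw : ‖1 - w‖ ≤ 1 / 4)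
    (hq : w ^ 2 - (1 + z) * w + z * (1 - (r : ℂ) ^ 2) = 0) :
    ∫ u in -(Real.pi / 2)..Real.pi / 2,
        Real.log ‖1 - 2 * z * ((2 * (1 - r ^ 2) * Real.sin u ^ 2 - 1 : ℝ) : ℂ) + z ^ 2‖
      = 2 * Real.pi * Real.log ‖w‖ := by
  have hw1 : 3 / 4 ≤ ‖w‖ := by
    have := norm_sub_norm_le 1 (1 - w)
    rw [norm_one, sub_sub_cancel] at this
    linarith
  have hw0 : w ≠ 0 := norm_pos_iff.1 (by linarith)
  -- The two roots of the quadratic are `w` and `B w`, since their product is `z (1 - r²)` and their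
  -- sum `1 + z`. The bounds `|z| ≤ 1/4` and `|w| ≥ 3/4` give `|B| ≤ 4/9`.
  set B : ℂ := z * (1 - (r : ℂ) ^ 2) / w ^ 2 with hBdef
  have hB : ‖B‖ < 1 := by
    have h1 : ‖(1 - (r : ℂ) ^ 2)‖ ≤ 1 := by
      rw [← Complex.ofReal_one, ← Complex.ofReal_pow, ← Complex.ofReal_sub, Complex.norm_real,
        Real.norm_eq_abs, abs_le]
      constructor <;> nlinarith
    rw [hBdef, norm_div, norm_mul, norm_pow, div_lt_one (by positivity)]
    nlinarith [norm_nonneg z, norm_nonneg (1 - (r : ℂ) ^ 2)]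
  have hBw : B * w ^ 2 = z * (1 - (r : ℂ) ^ 2) := div_mul_cancel₀ _ (pow_ne_zero 2 hw0)
  have hBw1 : B * w = 1 + z - w := by
    refine mul_right_cancel₀ hw0 ?_
    linear_combination hBw + hq
  -- Expanding the right side gives `w² + (B w)² + 2 B w² cos 2u`; the sum and product of the roots,
  -- with `cos 2u = 1 - 2 sin² u`, turn it into the left side.
  have hfac : ∀ u : ℝ, 1 - 2 * z * ((2 * (1 - r ^ 2) * Real.sin u ^ 2 - 1 : ℝ) : ℂ) + z ^ 2
      = w ^ 2 * (1 + B * Complex.exp (2 * u * Complex.I))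
        * (1 + B * Complex.exp (2 * (-u : ℝ) * Complex.I)) := by
    intro u
    set E := Complex.exp (2 * u * Complex.I) with hE
    set E' := Complex.exp (2 * (-u : ℝ) * Complex.I) with hE'
    have e1 : E * E' = 1 := by
      rw [hE, hE', ← Complex.exp_add]
      simp
    have e2 : E + E' = 2 * Complex.cos (2 * u) := by
      rw [Complex.two_cos, hE, hE']
      push_cast
      ring_nf
    have e3 : Complex.cos (2 * u) = 1 - 2 * Complex.sin u ^ 2 := by
      rw [Complex.cos_two_mul, Complex.cos_sq']
      ring
    push_cast
    have e4 : E + E' = 2 - 4 * Complex.sin u ^ 2 := by rw [e2, e3]; ring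
    linear_combination (-1 : ℂ) * (B * w ^ 2) * e4 - B ^ 2 * w ^ 2 * e1
      + (-(B * w) - (1 + z - w)) * hBw1 - (2 - 4 * Complex.sin u ^ 2) * hBw - 2 * hq
  have hcont := continuous_log_norm_one_add_mul_exp hB
  have hlog : ∀ u : ℝ,
      Real.log ‖1 - 2 * z * ((2 * (1 - r ^ 2) * Real.sin u ^ 2 - 1 : ℝ) : ℂ) + z ^ 2‖
      = 2 * Real.log ‖w‖ + Real.log ‖1 + B * Complex.exp (2 * u * Complex.I)‖
        + Real.log ‖1 + B * Complex.exp (2 * (-u : ℝ) * Complex.I)‖ := by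
    have hne : ∀ u : ℝ, ‖1 + B * Complex.exp (2 * u * Complex.I)‖ ≠ 0 := by
      intro u h
      rw [norm_eq_zero, add_eq_zero_iff_eq_neg] at h
      have h1 : ‖B * Complex.exp (2 * u * Complex.I)‖ = 1 := by rw [← norm_neg, ← h, norm_one]
      have : ‖Complex.exp (2 * u * Complex.I)‖ = 1 := by
        have := Complex.norm_exp_ofReal_mul_I (2 * u)
        push_cast at this
        exact this
      rw [norm_mul, this, mul_one] at h1
      linarith
    intro u
    have hw2 : ‖w‖ ^ 2 ≠ 0 := by positivity
    rw [hfac, norm_mul, norm_mul, norm_pow, Real.log_mul (mul_ne_zero hw2 (hne u)) (hne (-u)),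
      Real.log_mul hw2 (hne u), Real.log_pow]
    push_cast
    ring
  simp_rw [hlog]
  have h0 := integral_log_norm_one_add_mul_exp hB
  have h0' : ∫ u in -(Real.pi / 2)..Real.pi / 2,
      Real.log ‖1 + B * Complex.exp (2 * (-u : ℝ) * Complex.I)‖ = 0 := by
    rw [intervalIntegral.integral_comp_neg
      (fun u : ℝ => Real.log ‖1 + B * Complex.exp (2 * u * Complex.I)‖), neg_neg, h0]
  rw [intervalIntegral.integral_add, intervalIntegral.integral_add, h0, h0',
    intervalIntegral.integral_const]
  · rw [smul_eq_mul]; ring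
  · exact intervalIntegrable_const
  · exact hcont.intervalIntegrable _ _
  · exact intervalIntegrable_const.add (hcont.intervalIntegrable _ _)
  · exact (hcont.comp continuous_neg).intervalIntegrable _ _

theorem measurable_logKernel : Measurable (Function.uncurry logKernel) := by
  unfold logKernel Function.uncurry
  fun_prop

theorem integral_circleDensity_of_measurable {l r : ℝ} (hlr : l ≤ r) {f : ℝ → ℝ}
    (hf : Measurable f) (h0 : ∀ θ ∈ Set.Ioc l r, 0 ≤ f θ) {g : ℂ → ℝ} (hg : Measurable g) :
    ∫ ζ, g ζ ∂circleDensity (Set.Ioc l r) f = ∫ θ in l..r, f θ • g (circleMap 0 1 θ) := by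
  rw [circleDensity, integral_map (measurable_circleMap 0 1).aemeasurable
    hg.aestronglyMeasurable, integral_withDensity_eq_integral_toReal_smul (by fun_prop) (by simp),
    intervalIntegral.integral_of_le hlr]
  refine setIntegral_congr_fun measurableSet_Ioc fun θ hθ => ?_
  simp only [ENNReal.toReal_ofReal (h0 θ hθ)]

section

theorem arcDensity_nonneg {a : ℝ} (h0 : 0 ≤ a) :
    ∀ θ ∈ Set.Ioc (arcAngle a) (2 * Real.pi - arcAngle a), 0 ≤ arcDensity a θ := by
  intro θ hθ
  have hA0 : 0 ≤ Real.arcsin a := Real.arcsin_nonneg.2 h0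
  have h3 := hθ.1
  have h4 := hθ.2
  unfold arcAngle at h3 h4
  have := Real.sin_nonneg_of_nonneg_of_le_pi (x := θ / 2) (by linarith) (by linarith)
  unfold arcDensity
  positivity

variable {a : ℝ} (h0 : 0 ≤ a) (h1 : a < 1)
include h0 h1

/-- The function `u = -arcsin (cos (θ/2) / √(1 - a²))` is `π` times a distribution function of the
arc measure, up to a constant: in the variable `u` the measure becomes uniform. -/
theorem hasDerivAt_arcsin_cos_div {θ : ℝ}
    (hθ : θ ∈ Set.Ioo (arcAngle a) (2 * Real.pi - arcAngle a)) :
    HasDerivAt (fun θ => -Real.arcsin (Real.cos (θ / 2) / √(1 - a ^ 2)))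
      (Real.pi * arcDensity a θ) θ := by
  have hpi := Real.pi_pos
  have hA0 : 0 ≤ Real.arcsin a := Real.arcsin_nonneg.2 h0
  have hA1 : Real.arcsin a < Real.pi / 2 := Real.arcsin_lt_pi_div_two.2 h1
  have hc := Real.cos_arcsin a
  set c := √(1 - a ^ 2)
  have hcA : arcAngle a / 2 = Real.arcsin a := by unfold arcAngle; ring
  have hcpos : 0 < c := by
    rw [← hc]
    exact Real.cos_pos_of_mem_Ioo ⟨by linarith, hA1⟩
  have h3 := hθ.1
  have h4 := hθ.2
  unfold arcAngle at h3 h4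
  have hlt : Real.cos (θ / 2) < c := by
    rw [← hc]
    exact Real.cos_lt_cos_of_nonneg_of_le_pi hA0 (by linarith) (by linarith)
  have hgt : -c < Real.cos (θ / 2) := by
    rw [← hc, ← Real.cos_pi_sub]
    exact Real.cos_lt_cos_of_nonneg_of_le_pi (by linarith) (by linarith) (by linarith)
  have hu1 : Real.cos (θ / 2) / c < 1 := by rwa [div_lt_one hcpos]
  have hu2 : -1 < Real.cos (θ / 2) / c := by rw [lt_div_iff₀ hcpos]; linarith
  have hg : HasDerivAt (fun θ => Real.cos (θ / 2) / c) (-Real.sin (θ / 2) * (1 / 2) / c) θ :=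
    (((hasDerivAt_id θ).div_const 2).cos).div_const c
  refine ((Real.hasDerivAt_arcsin hu2.ne' hu1.ne).comp θ hg).neg.congr_deriv ?_
  have hsq : √(1 - (Real.cos (θ / 2) / c) ^ 2) = √(c ^ 2 - Real.cos (θ / 2) ^ 2) / c := by
    rw [show 1 - (Real.cos (θ / 2) / c) ^ 2 = (c ^ 2 - Real.cos (θ / 2) ^ 2) / c ^ 2 by
      field_simp, Real.sqrt_div' _ (sq_nonneg c), Real.sqrt_sq hcpos.le]
  have hroot : 0 < √(c ^ 2 - Real.cos (θ / 2) ^ 2) := by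
    apply Real.sqrt_pos.2
    nlinarith
  rw [hsq, arcDensity, hcA, hc]
  field_simp

/-- This is the substitution `cos (θ/2) = -√(1 - a²) sin u`, under which `ν_a` becomes `du/π` on
`[-π/2, π/2]`. -/
theorem integral_arcDensity_mul (g : ℝ → ℝ) :
    ∫ θ in arcAngle a..2 * Real.pi - arcAngle a, arcDensity a θ • g θ
      = Real.pi⁻¹ * ∫ u in -(Real.pi / 2)..Real.pi / 2,
          g (2 * Real.arccos (-(√(1 - a ^ 2) * Real.sin u))) := by
  have hpi := Real.pi_pos
  have hA0 : 0 ≤ Real.arcsin a := Real.arcsin_nonneg.2 h0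
  have hA1 : Real.arcsin a < Real.pi / 2 := Real.arcsin_lt_pi_div_two.2 h1
  have hcpos : 0 < √(1 - a ^ 2) := Real.sqrt_pos.2 (by nlinarith)
  have hle : arcAngle a ≤ 2 * Real.pi - arcAngle a := by unfold arcAngle; linarith
  have hcA : arcAngle a / 2 = Real.arcsin a := by unfold arcAngle; ring
  set F : ℝ → ℝ := fun θ => -Real.arcsin (Real.cos (θ / 2) / √(1 - a ^ 2)) with hF
  set G : ℝ → ℝ := fun u => g (2 * Real.arccos (-(√(1 - a ^ 2) * Real.sin u))) with hG
  have hFc : Continuous F := by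
    have := Real.continuous_arcsin
    fun_prop
  have hend1 : F (arcAngle a) = -(Real.pi / 2) := by
    simp only [hF]
    rw [hcA, Real.cos_arcsin, div_self hcpos.ne', Real.arcsin_one]
  have hend2 : F (2 * Real.pi - arcAngle a) = Real.pi / 2 := by
    simp only [hF]
    rw [show (2 * Real.pi - arcAngle a) / 2 = Real.pi - arcAngle a / 2 by ring, Real.cos_pi_sub,
      hcA, Real.cos_arcsin, neg_div, div_self hcpos.ne', Real.arcsin_neg, Real.arcsin_one, neg_neg]
  -- The density may blow up at the ends of the arc, so the substitution rule used is the one for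
  -- monotone maps, which needs the derivative only in the interior.
  have hsub := intervalIntegral.integral_deriv_smul_comp_of_deriv_nonneg (a := arcAngle a)
    (b := 2 * Real.pi - arcAngle a) (f := F) (f' := fun θ => Real.pi * arcDensity a θ) (g := G)
    hFc.continuousOn
    (fun θ hθ => hasDerivAt_arcsin_cos_div h0 h1
      (by rwa [min_eq_left hle, max_eq_right hle] at hθ))
    (fun θ hθ => mul_nonneg hpi.le (arcDensity_nonneg h0 θ (Set.Ioo_subset_Ioc_self
      (by rwa [min_eq_left hle, max_eq_right hle] at hθ))))
  rw [hend1, hend2] at hsub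
  rw [← hsub, ← intervalIntegral.integral_const_mul]
  refine intervalIntegral.integral_congr fun θ hθ => ?_
  rw [Set.uIcc_of_le hle] at hθ
  obtain ⟨h3, h4⟩ := hθ
  unfold arcAngle at h3 h4
  have hle1 : Real.cos (θ / 2) ≤ √(1 - a ^ 2) := by
    rw [← Real.cos_arcsin]
    exact Real.cos_le_cos_of_nonneg_of_le_pi hA0 (by linarith) (by linarith)
  have hge1 : -√(1 - a ^ 2) ≤ Real.cos (θ / 2) := by
    rw [← Real.cos_arcsin, ← Real.cos_pi_sub]
    exact Real.cos_le_cos_of_nonneg_of_le_pi (by linarith) (by linarith) (by linarith)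
  have hGF : G (F θ) = g θ := by
    simp only [hG, hF]
    rw [Real.sin_neg, Real.sin_arcsin (by rw [le_div_iff₀ hcpos]; linarith)
      (by rwa [div_le_one hcpos]), mul_neg, neg_neg, mul_div_cancel₀ _ hcpos.ne',
      Real.arccos_cos (by linarith) (by linarith)]
    congr 1
    ring
  simp only [Function.comp_apply, hGF, smul_eq_mul]
  field_simp

end

theorem continuous_logKernel_circleMap {z : ℂ} (hz : ‖z‖ < 1) :
    Continuous fun θ => logKernel z (circleMap 0 1 θ) := by
  unfold logKernel
  refine Continuous.log (by fun_prop) fun θ => ?_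
  rw [norm_ne_zero_iff]
  exact one_sub_mul_conj_ne_zero hz (by simp)

/-- The logarithmic potential of the equilibrium measure of an arc. -/
theorem integral_logKernel_arcMeasure {a : ℝ} (h0 : 0 ≤ a) (h1 : a ≤ 1) {z w : ℂ}
    (hz : ‖z‖ ≤ 1 / 4) (hw : ‖1 - w‖ ≤ 1 / 4)
    (hq : w ^ 2 - (1 + z) * w + z * (1 - (a : ℂ) ^ 2) = 0) :
    ∫ ζ, logKernel z ζ ∂arcMeasure a = Real.log ‖w‖ := by
  have hw0 : w ≠ 0 := by
    rintro rfl
    norm_num at hw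
  rcases h1.lt_or_eq with h1 | rfl
  swap
  -- For `a = 1` the quadratic is `w (w - (1 + z)) = 0`, and `ν_1 = δ_{-1}` has potential `log |1 +
  -- z|`.
  · have e : w = 1 + z := by
      refine mul_right_cancel₀ hw0 ?_
      simp only [Complex.ofReal_one] at hq
      linear_combination hq
    simp [arcMeasure, logKernel, e]
  have hpi := Real.pi_pos
  have hle : arcAngle a ≤ 2 * Real.pi - arcAngle a := by
    have hA1 : Real.arcsin a < Real.pi / 2 := Real.arcsin_lt_pi_div_two.2 h1
    unfold arcAngle; linarith
  have hmeas : Measurable (arcDensity a) := by unfold arcDensity; fun_prop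
  have hmeas' : Measurable (logKernel z) := measurable_logKernel.of_uncurry_left
  have hz1 : ‖z‖ < 1 := by linarith
  rw [arcMeasure, if_pos ⟨h0, h1⟩, integral_circleDensity_of_measurable hle hmeas
    (arcDensity_nonneg h0) hmeas',
    integral_arcDensity_mul h0 h1 fun θ => logKernel z (circleMap 0 1 θ)]
  set G : ℝ → ℝ := fun u =>
    logKernel z (circleMap 0 1 (2 * Real.arccos (-(√(1 - a ^ 2) * Real.sin u)))) with hG
  have hGc : Continuous G := by
    have := Real.continuous_arccos
    exact (continuous_logKernel_circleMap hz1).comp (by fun_prop)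
  have hsym : ∫ u in -(Real.pi / 2)..Real.pi / 2, G (-u)
      = ∫ u in -(Real.pi / 2)..Real.pi / 2, G u := by
    rw [intervalIntegral.integral_comp_neg, neg_neg]
  -- The reflection `u ↦ -u` is `θ ↦ 2π - θ`, complex conjugation on the arc. The two factors
  -- multiply to `(1 - z e^{-iθ})(1 - z e^{iθ}) = 1 - 2 z cos θ + z²`, where `cos θ = 2 (1 - a²)
  -- sin² u - 1`.
  have hsum : ∀ u, G u + G (-u)
      = Real.log ‖1 - 2 * z * ((2 * (1 - a ^ 2) * Real.sin u ^ 2 - 1 : ℝ) : ℂ) + z ^ 2‖ := by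
    intro u
    have hc2 : √(1 - a ^ 2) ^ 2 = 1 - a ^ 2 := Real.sq_sqrt (by nlinarith)
    have hc1 : √(1 - a ^ 2) ≤ 1 := Real.sqrt_le_one.2 (by nlinarith)
    set x := √(1 - a ^ 2) * Real.sin u with hx
    have hx1 : |x| ≤ 1 := by
      rw [hx, abs_mul, abs_of_nonneg (Real.sqrt_nonneg _)]
      nlinarith [Real.abs_sin_le_one u, abs_nonneg (Real.sin u), Real.sqrt_nonneg (1 - a ^ 2)]
    obtain ⟨hx1, hx2⟩ := abs_le.1 hx1
    set φ := 2 * Real.arccos (-x) with hφ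
    have hcos : Real.cos φ = 2 * (1 - a ^ 2) * Real.sin u ^ 2 - 1 := by
      rw [hφ, Real.cos_two_mul, Real.cos_arccos (by linarith) (by linarith)]
      linear_combination 2 * Real.sin u ^ 2 * hc2
    have hn : 2 * Real.arccos (-(√(1 - a ^ 2) * Real.sin (-u))) = 2 * Real.pi - φ := by
      rw [hφ, Real.arccos_neg x, Real.sin_neg, mul_neg, neg_neg]
      ring
    have e1 : conj (circleMap 0 1 φ) = Complex.cos φ - Complex.sin φ * Complex.I := by
      simp only [circleMap, zero_add, Complex.ofReal_one, one_mul]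
      rw [← Complex.exp_conj, map_mul, Complex.conj_I, Complex.conj_ofReal, mul_neg, ← neg_mul,
        Complex.exp_mul_I, Complex.cos_neg, Complex.sin_neg]
      ring
    have e2 : conj (circleMap 0 1 (2 * Real.pi - φ)) = Complex.cos φ + Complex.sin φ * Complex.I := by
      have : circleMap 0 1 (2 * Real.pi - φ) = conj (circleMap 0 1 φ) := by
        rw [sub_eq_neg_add, periodic_circleMap 0 1 (-φ)]
        simp only [circleMap, zero_add, Complex.ofReal_one, one_mul]
        rw [← Complex.exp_conj, map_mul, Complex.conj_I, Complex.conj_ofReal]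
        push_cast
        ring_nf
      rw [this, Complex.conj_conj]
      simp [circleMap, Complex.exp_mul_I]
    simp only [hG]
    rw [hn, logKernel, logKernel, ← Real.log_mul, ← norm_mul, e1, e2, ← hcos]
    · congr 2
      push_cast
      linear_combination z ^ 2 * Complex.cos_sq_add_sin_sq φ
        - z ^ 2 * Complex.sin φ ^ 2 * Complex.I_sq
    · exact norm_ne_zero_iff.2 (one_sub_mul_conj_ne_zero hz1 (by simp))
    · exact norm_ne_zero_iff.2 (one_sub_mul_conj_ne_zero hz1 (by simp))
  have htot : 2 * ∫ u in -(Real.pi / 2)..Real.pi / 2, G u = 2 * Real.pi * Real.log ‖w‖ := by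
    rw [← integral_log_norm_quadratic h0 h1.le hz hw hq, two_mul]
    nth_rw 2 [← hsym]
    have hGn : Continuous fun u => G (-u) := hGc.comp continuous_neg
    rw [← intervalIntegral.integral_add (hGc.intervalIntegrable _ _) (hGn.intervalIntegrable _ _)]
    exact intervalIntegral.integral_congr fun u _ => hsum u
  field_simp
  linarith

/-! ### Limits along `n / N → s` -/

theorem RatioLimit.map {E F : Type*} [TopologicalSpace E] [TopologicalSpace F] {X : ℕ → ℕ → E}
    {s : ℝ} {L : E} (h : RatioLimit X s L) {f : E → F} (hf : ContinuousAt f L) :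
    RatioLimit (fun m N => f (X m N)) s (f L) :=
  fun n N hn hN hs => hf.tendsto.comp (h n N hn hN hs)

theorem RatioLimit.prodMk {E F : Type*} [TopologicalSpace E] [TopologicalSpace F]
    {X : ℕ → ℕ → E} {Y : ℕ → ℕ → F} {s : ℝ} {L : E} {M : F} (hX : RatioLimit X s L)
    (hY : RatioLimit Y s M) : RatioLimit (fun m N => (X m N, Y m N)) s (L, M) :=
  fun n N hn hN hs => (hX n N hn hN hs).prodMk_nhds (hY n N hn hN hs)

/-- A bounded nonnegative quantity which is contracted by the shift `n ↦ n + 1`, up to a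
vanishing error, tends to zero. -/
theorem ratioLimit_zero_of_contraction {e d : ℕ → ℕ → ℝ} {q C s : ℝ} (hq0 : 0 ≤ q) (hq1 : q < 1)
    (he0 : ∀ m N, 0 ≤ e m N) (heC : ∀ m N, e m N ≤ C)
    (hrec : ∀ m N, e (m + 1) N ≤ q * e m N + d m N) (hd : RatioLimit d s 0) :
    RatioLimit e s 0 := by
  -- The bound `limsup e ≤ C q^i` is proved for all admissible sequences at once, because the
  -- induction step passes from `n_j` to `n_j - 1`, which has the same ratio limit.
  have key : ∀ i : ℕ, ∀ n N : ℕ → ℕ, Tendsto n atTop atTop → Tendsto N atTop atTop →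
      Tendsto (fun j => (n j : ℝ) / (N j : ℝ)) atTop (𝓝 s) →
      ∀ ε > 0, ∀ᶠ j in atTop, e (n j) (N j) ≤ C * q ^ i + ε := by
    intro i
    induction i with
    | zero =>
      intro n N _ _ _ ε hε
      exact Eventually.of_forall fun j => by simpa using (heC _ _).trans (by linarith)
    | succ i ih =>
      intro n N hn hN hs ε hε
      have hn' : Tendsto (fun j => n j - 1) atTop atTop := (tendsto_sub_atTop_nat 1).comp hn
      have hinv : Tendsto (fun j => ((N j : ℕ) : ℝ)⁻¹) atTop (𝓝 0) :=
        tendsto_inv_atTop_zero.comp (tendsto_natCast_atTop_atTop.comp hN)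
      have hs' : Tendsto (fun j => ((n j - 1 : ℕ) : ℝ) / (N j : ℝ)) atTop (𝓝 s) := by
        have h := hs.sub hinv
        rw [sub_zero] at h
        refine h.congr' ?_
        filter_upwards [hn.eventually_ge_atTop 1] with j hj
        rw [Nat.cast_sub hj, Nat.cast_one, sub_div, one_div]
      filter_upwards [ih _ N hn' hN hs' (ε / 2) (by positivity), hn.eventually_ge_atTop 1,
        (hd _ N hn' hN hs').eventually_lt_const (show (0 : ℝ) < ε / 2 by positivity)]
        with j h1 h2 h3
      have h4 := hrec (n j - 1) (N j)
      rw [Nat.sub_add_cancel h2] at h4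
      have h5 := mul_le_mul_of_nonneg_left h1 hq0
      have h6 : q * (ε / 2) ≤ ε / 2 := by nlinarith
      rw [pow_succ]
      linarith
  intro n N hn hN hs
  rw [Metric.tendsto_atTop']
  intro ε hε
  have hpow : Tendsto (fun i : ℕ => C * q ^ i) atTop (𝓝 0) := by
    simpa using (tendsto_pow_atTop_nhds_zero_of_lt_one hq0 hq1).const_mul C
  obtain ⟨i, hi⟩ := (hpow.eventually_lt_const (show (0 : ℝ) < ε / 2 by positivity)).exists
  obtain ⟨j0, hj0⟩ := eventually_atTop.1 (key i n N hn hN hs (ε / 2) (by positivity))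
  refine ⟨j0, fun j hj => ?_⟩
  rw [Real.dist_0_eq_abs, abs_of_nonneg (he0 _ _)]
  linarith [hj0 j hj.le]

theorem ratioLimit_schurIterate {a : ℕ → ℕ → ℂ} (ha : ∀ n N, ‖a n N‖ < 1) {s : ℝ} {α : ℂ}
    (hα : ‖α‖ ≤ 1) (hlim : RatioLimit a s α) {z b : ℂ} (hz0 : z ≠ 0) (hz : ‖z‖ ≤ 1 / 4)
    (hb : ‖b‖ ≤ 1) (hfix : schurStep z α b = b) :
    RatioLimit (fun m N => schurIterate (fun k => a k N) z m) s b := by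
  have hz1 : ‖z‖ ≤ 1 := by linarith
  have hS : ∀ m N, ‖schurIterate (fun k => a k N) z m‖ ≤ 1 := fun m N =>
    norm_schurIterate_le (fun k => ha k N) hz0 hz1 m
  -- The error of the contraction is the displacement of the limiting fixed point `b` by the step
  -- with coefficient `a m N` in place of its limit.
  have hd : RatioLimit (fun m N => dist (schurStep z (a m N) b) b) s 0 := by
    have hc : ContinuousAt (fun β => dist (schurStep z β b) b) α := by
      unfold schurStep
      have := one_sub_mul_mul_ne_zero hz hα hb
      fun_prop (disch := assumption)
    have := hlim.map hc
    simpa only [hfix, dist_self] using this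
  have he : RatioLimit (fun m N => dist (schurIterate (fun k => a k N) z m) b) s 0 := by
    refine ratioLimit_zero_of_contraction (q := 4 / 9) (C := 2) (by norm_num) (by norm_num)
      (fun _ _ => dist_nonneg) (fun m N => ?_) (fun m N => ?_) hd
    · refine (dist_le_norm_add_norm _ _).trans ?_
      linarith [hS m N]
    · rw [schurIterate_succ (fun k => ha k N) hz0 hz1]
      refine (dist_triangle _ (schurStep z (a m N) b) _).trans ?_
      gcongr
      exact dist_schurStep_le hz (ha m N).le (hS m N) hb
  exact fun n N hn hN hs => tendsto_iff_dist_tendsto_zero.2 (he n N hn hN hs)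

theorem sum_range_eq_integral_floor (g : ℕ → ℝ) (n : ℕ) :
    ∑ m ∈ Finset.range n, g m = ∫ u in (0 : ℝ)..n, g ⌊u⌋₊ := by
  have hpiece : ∀ m : ℕ, Set.EqOn (fun u : ℝ => g ⌊u⌋₊) (fun _ => g m)
      (Set.Ioo (m : ℝ) (m + 1 : ℕ)) := by
    intro m u hu
    have : ⌊u⌋₊ = m := by
      rw [Nat.floor_eq_iff ((Nat.cast_nonneg m).trans hu.1.le)]
      exact ⟨hu.1.le, by simpa using hu.2⟩
    simp only [this]
  have hle : ∀ m : ℕ, (m : ℝ) ≤ (m + 1 : ℕ) := fun m => by simp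
  have hint : ∀ m : ℕ, IntervalIntegrable (fun u : ℝ => g ⌊u⌋₊) volume (m : ℝ) (m + 1 : ℕ) := by
    intro m
    rw [intervalIntegrable_iff_integrableOn_Ioo_of_le (hle m)]
    exact (integrableOn_congr_fun (hpiece m) measurableSet_Ioo).2 (by simp)
  have h := intervalIntegral.sum_integral_adjacent_intervals (f := fun u : ℝ => g ⌊u⌋₊)
    (μ := volume) (a := fun m : ℕ => (m : ℝ)) (n := n) fun m _ => hint m
  rw [Nat.cast_zero] at h
  rw [← h]
  refine Finset.sum_congr rfl fun m _ => ?_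
  rw [intervalIntegral.integral_of_le (hle m), integral_Ioc_eq_integral_Ioo,
    setIntegral_congr_fun measurableSet_Ioo (hpiece m)]
  simp

/-- Riemann sums along `n / N → t`. -/
theorem ratioLimit_average {X : ℕ → ℕ → ℝ} {C t : ℝ} (ht : 0 < t) (hX : ∀ m N, |X m N| ≤ C)
    {L : ℝ → ℝ} (hL : ∀ᵐ s ∂(volume.restrict (Set.Icc 0 t)), RatioLimit X s (L s)) :
    RatioLimit (fun n N => (n : ℝ)⁻¹ * ∑ m ∈ Finset.range n, X m N) t
      (t⁻¹ * ∫ s in Set.Icc 0 t, L s) := by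
  intro n N hn hN hs
  -- With `u = (n/t) s` the mean over `m < n` becomes `t⁻¹ ∫_0^t X ⌊n s / t⌋ N ds`. For fixed `s >
  -- 0` the index divided by `N` tends to `s`, and dominated convergence applies.
  have hlim : Tendsto (fun j => ∫ s in Set.Icc 0 t, X ⌊(n j / t : ℝ) * s⌋₊ (N j)) atTop
      (𝓝 (∫ s in Set.Icc 0 t, L s)) := by
    refine tendsto_integral_of_dominated_convergence (fun _ => C) (fun j => ?_) (by simp)
      (fun j => ae_of_all _ fun s => by simpa using hX _ _) ?_
    · have h1 : Measurable fun s : ℝ => ⌊(n j / t : ℝ) * s⌋₊ :=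
        Nat.measurable_floor.comp (by fun_prop)
      exact (((measurable_of_countable fun m => X m (N j))).comp h1).aestronglyMeasurable
    -- At `s = 0` the index would stay `0` instead of tending to infinity.
    · have hne : ∀ᵐ s ∂(volume.restrict (Set.Icc 0 t)), s ≠ 0 :=
        ae_restrict_of_ae (Measure.ae_ne volume 0)
      filter_upwards [hL, hne, ae_restrict_mem measurableSet_Icc] with s h1 h2 h3
      have hs0 : 0 < s := lt_of_le_of_ne h3.1 (Ne.symm h2)
      have hn' : Tendsto (fun j => (n j / t : ℝ) * s) atTop atTop :=
        ((tendsto_natCast_atTop_atTop.comp hn).atTop_div_const ht).atTop_mul_const hs0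
      refine h1 _ N (tendsto_nat_floor_atTop.comp hn') hN ?_
      have h4 : Tendsto (fun j => ((n j / t : ℝ) * s) / N j) atTop (𝓝 s) := by
        have := (hs.div_const t).mul_const s
        rw [div_self ht.ne', one_mul] at this
        refine this.congr fun j => ?_
        ring
      have h5 := (tendsto_nat_floor_div_atTop (R := ℝ)).comp hn'
      have h6 := h5.mul h4
      rw [one_mul] at h6
      refine h6.congr' ?_
      filter_upwards [hn'.eventually_gt_atTop 0] with j hj
      simp only [Function.comp_apply]
      rw [div_mul_div_cancel₀ hj.ne']
  refine (hlim.const_mul t⁻¹).congr' ?_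
  filter_upwards [hn.eventually_gt_atTop 0] with j hj
  have hnj : (0 : ℝ) < n j := by exact_mod_cast hj
  rw [sum_range_eq_integral_floor (fun m => X m (N j)), integral_Icc_eq_integral_Ioc,
    ← intervalIntegral.integral_of_le ht.le,
    intervalIntegral.integral_comp_mul_left (fun u : ℝ => X ⌊u⌋₊ (N j)) (by positivity),
    mul_zero, div_mul_cancel₀ _ ht.ne', smul_eq_mul]
  field_simp

/-! ### Moments from logarithmic potentials -/

theorem integral_exp_int_mul_I (l : ℤ) :
    ∫ φ in (0 : ℝ)..2 * Real.pi, Complex.exp (l * φ * Complex.I)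
      = if l = 0 then 2 * Real.pi else 0 := by
  split_ifs with h
  · subst h
    simp
  · have hc : (l : ℂ) * Complex.I ≠ 0 := mul_ne_zero (Int.cast_ne_zero.2 h) Complex.I_ne_zero
    have e : ∀ φ : ℝ, Complex.exp (l * φ * Complex.I) = Complex.exp (l * Complex.I * φ) := by
      intro φ
      ring_nf
    simp_rw [e]
    rw [integral_exp_mul_complex hc]
    have : (l : ℂ) * Complex.I * (2 * Real.pi : ℝ) = l * (2 * Real.pi * Complex.I) := by
      push_cast
      ring
    rw [this, Complex.exp_int_mul_two_pi_mul_I]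
    simp

/-- This is the real part of the Taylor series of `log (1 - v)`. The term `n = 0` vanishes because
division by zero gives zero. -/
theorem hasSum_log_norm_one_sub {v : ℂ} (hv : ‖v‖ < 1) :
    HasSum (fun n : ℕ => -(v ^ n + conj v ^ n) / (2 * n)) (Real.log ‖1 - v‖ : ℂ) := by
  have h := Complex.hasSum_taylorSeries_neg_log hv
  have h' := (h.add (Complex.hasSum_conj'.2 h)).mul_left (-1 / 2 : ℂ)
  have e : -1 / 2 * (-Complex.log (1 - v) + conj (-Complex.log (1 - v)))
      = (Real.log ‖1 - v‖ : ℂ) := by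
    rw [← Complex.log_re, Complex.add_conj, Complex.neg_re]
    push_cast
    ring
  rw [← e]
  refine (funext fun n => ?_ : (fun n : ℕ => -(v ^ n + conj v ^ n) / (2 * n)) = _) ▸ h'
  rw [map_div₀, map_pow, Complex.conj_natCast]
  ring

/-- In the series for `log |1 - u e^{iφ}|` the powers `e^{inφ}` are orthogonal to `e^{-ikφ}` as `k +
n > 0`, and among the powers `e^{-inφ}` only `n = k` survives. -/
theorem integral_exp_mul_log_norm {u : ℂ} (hu : ‖u‖ < 1) {k : ℕ} (hk : k ≠ 0) :
    ∫ φ in (0 : ℝ)..2 * Real.pi, Complex.exp (k * φ * Complex.I) *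
        (Real.log ‖1 - u * Complex.exp (φ * Complex.I)‖ : ℂ) = -(Real.pi * conj u ^ k / k) := by
  have hn : ∀ φ : ℝ, ‖u * Complex.exp (φ * Complex.I)‖ = ‖u‖ := fun φ => by
    rw [norm_mul, Complex.norm_exp_ofReal_mul_I, mul_one]
  have hsum := intervalIntegral.hasSum_integral_of_dominated_convergence (μ := volume)
    (a := 0) (b := 2 * Real.pi)
    (F := fun (n : ℕ) (φ : ℝ) => Complex.exp (k * φ * Complex.I) *
      (-((u * Complex.exp (φ * Complex.I)) ^ n + conj (u * Complex.exp (φ * Complex.I)) ^ n)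
        / (2 * n)))
    (f := fun φ => Complex.exp (k * φ * Complex.I) *
        (Real.log ‖1 - u * Complex.exp (φ * Complex.I)‖ : ℂ))
    (fun n _ => ‖u‖ ^ n) (fun n => ?_) (fun n => ?_) ?_ ?_ ?_
  · have hterm : ∀ n : ℕ, ∫ φ in (0 : ℝ)..2 * Real.pi, Complex.exp (k * φ * Complex.I) *
        (-((u * Complex.exp (φ * Complex.I)) ^ n + conj (u * Complex.exp (φ * Complex.I)) ^ n)
          / (2 * n)) = if n = k then -(Real.pi * conj u ^ k / k) else 0 := by
      intro n
      have e : ∀ φ : ℝ, Complex.exp (k * φ * Complex.I) *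
          (-((u * Complex.exp (φ * Complex.I)) ^ n + conj (u * Complex.exp (φ * Complex.I)) ^ n)
          / (2 * n)) = -u ^ n / (2 * n) * Complex.exp ((k + n : ℤ) * φ * Complex.I)
            + -conj u ^ n / (2 * n) * Complex.exp ((k - n : ℤ) * φ * Complex.I) := by
        intro φ
        have e1 : Complex.exp ((k + n : ℤ) * φ * Complex.I)
            = Complex.exp (k * φ * Complex.I) * Complex.exp (φ * Complex.I) ^ n := by
          rw [← Complex.exp_nat_mul, ← Complex.exp_add]
          push_cast
          ring_nf
        have e2 : Complex.exp ((k - n : ℤ) * φ * Complex.I)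
            = Complex.exp (k * φ * Complex.I) * conj (Complex.exp (φ * Complex.I)) ^ n := by
          rw [← Complex.exp_conj, ← Complex.exp_nat_mul, ← Complex.exp_add, map_mul,
            Complex.conj_ofReal, Complex.conj_I]
          push_cast
          ring_nf
        rw [e1, e2, map_mul, mul_pow, mul_pow]
        ring
      simp_rw [e]
      have hc : ∀ l : ℤ, Continuous fun φ : ℝ => Complex.exp (l * φ * Complex.I) :=
        fun l => by fun_prop
      rw [intervalIntegral.integral_add (((hc _).const_mul _).intervalIntegrable _ _)
        (((hc _).const_mul _).intervalIntegrable _ _), intervalIntegral.integral_const_mul,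
        intervalIntegral.integral_const_mul, integral_exp_int_mul_I, integral_exp_int_mul_I,
        if_neg (by omega)]
      by_cases h : n = k
      · subst h
        have : (n : ℂ) ≠ 0 := Nat.cast_ne_zero.2 hk
        simp
        field_simp
      · rw [if_neg (by omega), if_neg h]
        simp
    simp_rw [hterm] at hsum
    exact hsum.unique (hasSum_ite_eq k _)
  · exact (Continuous.aestronglyMeasurable (by fun_prop))
  · refine ae_of_all _ fun φ _ => ?_
    have h1 : ‖Complex.exp (k * φ * Complex.I)‖ = 1 := by
      have := Complex.norm_exp_ofReal_mul_I (k * φ)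
      push_cast at this
      exact this
    rw [norm_mul, h1, one_mul, norm_div, norm_neg]
    rcases Nat.eq_zero_or_pos n with rfl | hpos
    · simp
    have hpos' : (1 : ℝ) ≤ n := by exact_mod_cast hpos
    have h2 : ‖(2 * n : ℂ)‖ = 2 * n := by simp
    rw [h2, div_le_iff₀ (by positivity)]
    refine (norm_add_le _ _).trans ?_
    rw [norm_pow, norm_pow, Complex.norm_conj, hn]
    nlinarith [pow_nonneg (norm_nonneg u) n]
  · exact ae_of_all _ fun φ _ => summable_geometric_of_lt_one (norm_nonneg u) hu
  · exact intervalIntegrable_const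
  · exact ae_of_all _ fun φ _ => (hasSum_log_norm_one_sub (by rwa [hn])).mul_left _

theorem abs_logKernel_le {z ζ : ℂ} (hz : ‖z‖ ≤ 1 / 4) (hζ : ‖ζ‖ ≤ 1) : |logKernel z ζ| ≤ 1 := by
  have := abs_log_norm_one_sub_mul_mul_le (α := 1) (b := conj ζ) hz (by simp) (by simpa using hζ)
  simpa [logKernel] using this

theorem norm_circleMap_quarter (φ : ℝ) : ‖circleMap 0 (1 / 4) φ‖ = 1 / 4 := by simp

theorem abs_integral_logKernel_le {μ : Measure ℂ} [IsProbabilityMeasure μ]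
    (hμ : ∀ᵐ ζ ∂μ, ‖ζ‖ ≤ 1) {z : ℂ} (hz : ‖z‖ ≤ 1 / 4) : |∫ ζ, logKernel z ζ ∂μ| ≤ 1 := by
  have := norm_integral_le_of_norm_le_const (μ := μ) (f := logKernel z) (C := 1)
    (hμ.mono fun ζ hζ => abs_logKernel_le hz hζ)
  simpa using this

theorem measurable_integral_logKernel (μ : Measure ℂ) [SFinite μ] :
    Measurable fun z => ∫ ζ, logKernel z ζ ∂μ :=
  (measurable_logKernel.stronglyMeasurable.integral_prod_right).measurable

/-- For fixed `ζ` the Fourier integral above with `u = ζ̄/4` yields `ζ^k / 4^k`, whence the factor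
`4^k`; Fubini then integrates over `ζ`, the kernel being bounded by `1`. -/
theorem integral_pow_eq_integral_logKernel {μ : Measure ℂ} [IsFiniteMeasure μ]
    (hμ : ∀ᵐ ζ ∂μ, ‖ζ‖ ≤ 1) {k : ℕ} (hk : k ≠ 0) :
    ∫ ζ, ζ ^ k ∂μ = -(k * 4 ^ k / Real.pi) * ∫ φ in (0 : ℝ)..2 * Real.pi,
      Complex.exp (k * φ * Complex.I) * (∫ ζ, logKernel (circleMap 0 (1 / 4) φ) ζ ∂μ : ℝ) := by
  have hpi : (Real.pi : ℂ) ≠ 0 := Complex.ofReal_ne_zero.2 Real.pi_ne_zero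
  have hk' : (k : ℂ) ≠ 0 := Nat.cast_ne_zero.2 hk
  have hinner : ∀ᵐ ζ ∂μ, ζ ^ k = -(k * 4 ^ k / Real.pi) * ∫ φ in (0 : ℝ)..2 * Real.pi,
      Complex.exp (k * φ * Complex.I) * (logKernel (circleMap 0 (1 / 4) φ) ζ : ℂ) := by
    filter_upwards [hμ] with ζ hζ
    have hu : ‖1 / 4 * conj ζ‖ < 1 := by
      rw [norm_mul, Complex.norm_conj]
      norm_num
      linarith
    have h := integral_exp_mul_log_norm hu hk
    have e : ∀ φ : ℝ, logKernel (circleMap 0 (1 / 4) φ) ζ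
        = Real.log ‖1 - 1 / 4 * conj ζ * Complex.exp (φ * Complex.I)‖ := by
      intro φ
      simp only [logKernel, circleMap, zero_add]
      push_cast
      ring_nf
    simp_rw [e]
    rw [h, map_mul, Complex.conj_conj, mul_pow]
    simp only [map_div₀, map_one, map_ofNat, div_pow, one_pow]
    field_simp
  rw [integral_congr_ae hinner, integral_const_mul]
  congr 1
  simp_rw [intervalIntegral.integral_of_le Real.two_pi_pos.le]
  rw [integral_integral_swap]
  · refine integral_congr_ae (ae_of_all _ fun φ => ?_)
    simp only
    rw [integral_const_mul, integral_complex_ofReal]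
  · have hg : Measurable fun p : ℂ × ℝ => (circleMap 0 (1 / 4) p.2, p.1) :=
      ((measurable_circleMap 0 (1 / 4)).comp measurable_snd).prodMk measurable_fst
    have hm : Measurable fun p : ℂ × ℝ => logKernel (circleMap 0 (1 / 4) p.2) p.1 := by
      have := measurable_logKernel.comp hg
      simpa only [Function.comp_def, Function.uncurry] using this
    refine Integrable.of_bound (C := 1) (Measurable.aestronglyMeasurable ?_) ?_
    · exact Measurable.mul (by fun_prop) (Complex.measurable_ofReal.comp hm)
    · have := (Measure.quasiMeasurePreserving_fst (μ := μ)
        (ν := volume.restrict (Set.Ioc 0 (2 * Real.pi)))).ae hμ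
      filter_upwards [this] with p hp
      have h1 : ‖Complex.exp (k * p.2 * Complex.I)‖ = 1 := by
        have := Complex.norm_exp_ofReal_mul_I (k * p.2)
        push_cast at this
        exact this
      simp only [Function.uncurry]
      rw [norm_mul, h1, one_mul, Complex.norm_real]
      exact abs_logKernel_le (norm_circleMap_quarter _).le hp

/-- Convergence of logarithmic potentials on a circle implies convergence of moments. -/
theorem tendsto_integral_pow_of_tendsto_logKernel {μ : ℕ → Measure ℂ} {ν : Measure ℂ}
    [∀ j, IsFiniteMeasure (μ j)] [IsFiniteMeasure ν]
    (hprob : ∀ᶠ j in atTop, IsProbabilityMeasure (μ j))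
    (hμ : ∀ j, ∀ᵐ ζ ∂μ j, ‖ζ‖ ≤ 1) (hν : ∀ᵐ ζ ∂ν, ‖ζ‖ ≤ 1)
    (hU : ∀ z : ℂ, ‖z‖ = 1 / 4 →
      Tendsto (fun j => ∫ ζ, logKernel z ζ ∂μ j) atTop (𝓝 (∫ ζ, logKernel z ζ ∂ν)))
    {k : ℕ} (hk : k ≠ 0) :
    Tendsto (fun j => ∫ ζ, ζ ^ k ∂μ j) atTop (𝓝 (∫ ζ, ζ ^ k ∂ν)) := by
  rw [integral_pow_eq_integral_logKernel hν hk]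
  simp_rw [fun j => integral_pow_eq_integral_logKernel (hμ j) hk]
  refine Tendsto.const_mul _ ?_
  have hexp : ∀ φ : ℝ, ‖Complex.exp (k * φ * Complex.I)‖ = 1 := fun φ => by
    have := Complex.norm_exp_ofReal_mul_I (k * φ)
    push_cast at this
    exact this
  refine intervalIntegral.tendsto_integral_filter_of_dominated_convergence (fun _ => 1)
    (Eventually.of_forall fun j => ?_) ?_ intervalIntegrable_const
    (ae_of_all _ fun φ _ => ?_)
  · have h1 := (measurable_integral_logKernel (μ j)).comp (measurable_circleMap 0 (1 / 4))
    refine Measurable.aestronglyMeasurable (Measurable.mul (by fun_prop) ?_)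
    exact Complex.measurable_ofReal.comp h1
  · filter_upwards [hprob] with j hj
    refine ae_of_all _ fun φ _ => ?_
    rw [norm_mul, hexp, one_mul, Complex.norm_real]
    exact abs_integral_logKernel_le (hμ j) (norm_circleMap_quarter φ).le
  · refine Tendsto.const_mul _ ?_
    exact (Complex.continuous_ofReal.tendsto _).comp (hU _ (norm_circleMap_quarter φ))

/-! ### Weak convergence from moments -/

theorem measurable_coe_arg : Measurable fun ζ : ℂ => (ζ.arg : AddCircle (2 * Real.pi)) :=
  (AddCircle.continuous_mk' (2 * Real.pi)).measurable.comp Complex.measurable_arg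

/-- This transports integrals over the circle in `ℂ` to `AddCircle (2π)`, where the density of the
trigonometric polynomials is available. -/
theorem fourier_arg {ζ : ℂ} (hζ : ‖ζ‖ = 1) (n : ℤ) :
    fourier n (ζ.arg : AddCircle (2 * Real.pi)) = ζ ^ n := by
  have h := Complex.norm_mul_exp_arg_mul_I ζ
  rw [hζ, Complex.ofReal_one, one_mul] at h
  rw [fourier_coe_apply]
  conv_rhs => rw [← h, ← Complex.exp_int_mul]
  congr 1
  have : (Real.pi : ℂ) ≠ 0 := Complex.ofReal_ne_zero.2 Real.pi_ne_zero
  push_cast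
  field_simp

/-- On the unit circle, convergence of the moments of non-negative order implies weak
convergence of probability measures. -/
theorem tendsto_of_tendsto_integral_pow {μ : ℕ → FiniteMeasure ℂ} {ν : FiniteMeasure ℂ}
    (hprob : ∀ᶠ j in atTop, IsProbabilityMeasure (μ j : Measure ℂ))
    [IsProbabilityMeasure (ν : Measure ℂ)]
    (hμ : ∀ j, ∀ᵐ ζ ∂(μ j : Measure ℂ), ‖ζ‖ = 1) (hν : ∀ᵐ ζ ∂(ν : Measure ℂ), ‖ζ‖ = 1)
    (hmom : ∀ k : ℕ, k ≠ 0 → Tendsto (fun j => ∫ ζ, ζ ^ k ∂(μ j : Measure ℂ)) atTop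
      (𝓝 (∫ ζ, ζ ^ k ∂(ν : Measure ℂ)))) :
    Tendsto μ atTop (𝓝 ν) := by
  have : Fact (0 < 2 * Real.pi) := ⟨Real.two_pi_pos⟩
  let A : ℂ → AddCircle (2 * Real.pi) := fun ζ => (ζ.arg : AddCircle (2 * Real.pi))
  have hint : ∀ (m : FiniteMeasure ℂ) (g : C(AddCircle (2 * Real.pi), ℂ)),
      Integrable (fun ζ => g (A ζ)) (m : Measure ℂ) := fun m g =>
    Integrable.of_bound (g.continuous.measurable.comp measurable_coe_arg).aestronglyMeasurable
      ‖g‖ (ae_of_all _ fun ζ => g.norm_coe_le_norm _)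
  have hpos : ∀ k : ℕ, Tendsto (fun j => ∫ ζ, ζ ^ k ∂(μ j : Measure ℂ)) atTop
      (𝓝 (∫ ζ, ζ ^ k ∂(ν : Measure ℂ))) := by
    intro k
    rcases eq_or_ne k 0 with rfl | hk
    · refine tendsto_nhds_of_eventually_eq ?_
      filter_upwards [hprob] with j hj
      simp
    · exact hmom k hk
  have hfour : ∀ n : ℤ, Tendsto (fun j => ∫ ζ, fourier n (A ζ) ∂(μ j : Measure ℂ)) atTop
      (𝓝 (∫ ζ, fourier n (A ζ) ∂(ν : Measure ℂ))) := by
    intro n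
    have hcongr : ∀ {m : FiniteMeasure ℂ}, (∀ᵐ ζ ∂(m : Measure ℂ), ‖ζ‖ = 1) →
        ∫ ζ, fourier n (A ζ) ∂(m : Measure ℂ) = ∫ ζ, ζ ^ n ∂(m : Measure ℂ) := fun hm =>
      integral_congr_ae (hm.mono fun ζ hζ => fourier_arg hζ n)
    rw [hcongr hν]
    simp_rw [fun j => hcongr (hμ j)]
    obtain ⟨k, rfl | rfl⟩ := n.eq_nat_or_neg
    · simpa using hpos k
    -- On the circle `ζ⁻¹ = ζ̄`, so negative moments are conjugates of positive ones.
    · have hconj : ∀ {m : FiniteMeasure ℂ}, (∀ᵐ ζ ∂(m : Measure ℂ), ‖ζ‖ = 1) →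
          ∫ ζ, ζ ^ (-(k : ℤ)) ∂(m : Measure ℂ) = conj (∫ ζ, ζ ^ k ∂(m : Measure ℂ)) := by
        intro m hm
        rw [← integral_conj]
        refine integral_congr_ae (hm.mono fun ζ hζ => ?_)
        simp only
        rw [zpow_neg, zpow_natCast, map_pow, ← inv_pow, Complex.inv_eq_conj hζ]
      rw [hconj hν]
      simp_rw [fun j => hconj (hμ j)]
      exact (Complex.continuous_conj.tendsto _).comp (hpos k)
  have hspan : ∀ g ∈ Submodule.span ℂ (Set.range (@fourier (2 * Real.pi))),
      Tendsto (fun j => ∫ ζ, g (A ζ) ∂(μ j : Measure ℂ)) atTop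
        (𝓝 (∫ ζ, g (A ζ) ∂(ν : Measure ℂ))) := by
    intro g hg
    induction hg using Submodule.span_induction with
    | mem g hg =>
      obtain ⟨n, rfl⟩ := hg
      exact hfour n
    | zero => simp
    | add f g _ _ hf hg =>
      simp only [ContinuousMap.add_apply]
      rw [integral_add (hint _ _) (hint _ _)]
      simp_rw [fun j => integral_add (hint (μ j) f) (hint (μ j) g)]
      exact hf.add hg
    | smul c g _ hg =>
      simp only [ContinuousMap.smul_apply, integral_smul]
      exact hg.const_smul c
  rw [FiniteMeasure.tendsto_iff_forall_integral_rclike_tendsto ℂ]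
  intro f
  let F : C(AddCircle (2 * Real.pi), ℂ) :=
    f.toContinuousMap.comp ⟨fun x => (AddCircle.toCircle x : ℂ), by fun_prop⟩
  have hF : ∀ ζ : ℂ, ‖ζ‖ = 1 → F (A ζ) = f ζ := by
    intro ζ hζ
    have h := fourier_arg hζ 1
    rw [fourier_one, zpow_one] at h
    exact congrArg f h
  have hFint : ∀ {m : FiniteMeasure ℂ}, (∀ᵐ ζ ∂(m : Measure ℂ), ‖ζ‖ = 1) →
      ∫ ζ, f ζ ∂(m : Measure ℂ) = ∫ ζ, F (A ζ) ∂(m : Measure ℂ) := fun hm =>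
    integral_congr_ae (hm.mono fun ζ hζ => (hF ζ hζ).symm)
  rw [hFint hν]
  simp_rw [fun j => hFint (hμ j)]
  rw [Metric.tendsto_atTop']
  intro ε hε
  have hmem : F ∈ (Submodule.span ℂ (Set.range (@fourier (2 * Real.pi)))).topologicalClosure := by
    rw [span_fourier_closure_eq_top]
    trivial
  -- A trigonometric polynomial uniformly within `ε/3` of the test function changes each integral
  -- against a probability measure by less than `ε/3`.
  obtain ⟨g, hg, hgF⟩ := Metric.mem_closure_iff.1 hmem (ε / 3) (by positivity)
  rw [dist_eq_norm] at hgF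
  have hdiff : ∀ m : FiniteMeasure ℂ, IsProbabilityMeasure (m : Measure ℂ) →
      dist (∫ ζ, F (A ζ) ∂(m : Measure ℂ)) (∫ ζ, g (A ζ) ∂(m : Measure ℂ)) < ε / 3 := by
    intro m hm
    rw [dist_eq_norm, ← integral_sub (hint m F) (hint m g)]
    refine lt_of_le_of_lt ?_ hgF
    have := norm_integral_le_of_norm_le_const (μ := (m : Measure ℂ))
      (f := fun ζ => F (A ζ) - g (A ζ)) (C := ‖F - g‖)
      (ae_of_all _ fun ζ => (F - g).norm_coe_le_norm (A ζ))
    simpa using this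
  have hev := (Metric.tendsto_nhds.1 (hspan g hg) (ε / 3) (by positivity)).and hprob
  obtain ⟨j0, hj0⟩ := eventually_atTop.1 hev
  refine ⟨j0, fun j hj => ?_⟩
  obtain ⟨h1, h2⟩ := hj0 j hj.le
  have h3 := hdiff (μ j) h2
  have h4 := hdiff ν inferInstance
  rw [dist_comm] at h4
  have h5 := dist_triangle4 (∫ ζ, F (A ζ) ∂(μ j : Measure ℂ)) (∫ ζ, g (A ζ) ∂(μ j : Measure ℂ))
    (∫ ζ, g (A ζ) ∂(ν : Measure ℂ)) (∫ ζ, F (A ζ) ∂(ν : Measure ℂ))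
  linarith

/-! ### The averaged equilibrium measure -/

theorem ae_norm_eq_one_of_sphere {μ : Measure ℂ} (h : μ (Metric.sphere 0 1)ᶜ = 0) :
    ∀ᵐ ζ ∂μ, ‖ζ‖ = 1 := by
  have : ∀ᵐ ζ ∂μ, ζ ∈ Metric.sphere (0 : ℂ) 1 := h
  exact this.mono fun ζ hζ => mem_sphere_zero_iff_norm.1 hζ

theorem arcMeasure_compl_sphere (a : ℝ) : arcMeasure a (Metric.sphere 0 1)ᶜ = 0 := by
  have hm : MeasurableSet (Metric.sphere (0 : ℂ) 1)ᶜ := Metric.isClosed_sphere.measurableSet.compl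
  unfold arcMeasure
  split_ifs
  · rw [circleDensity, Measure.map_apply (measurable_circleMap 0 1) hm]
    have : circleMap 0 1 ⁻¹' (Metric.sphere (0 : ℂ) 1)ᶜ = ∅ := by
      ext θ
      simp
    rw [this, measure_empty]
  · rw [Measure.dirac_apply' _ hm]
    simp

section

variable {t : ℝ} {α : ℝ → ℂ} (hα : AEMeasurable α (volume.restrict (Set.Icc 0 t)))
include hα

theorem averageArcMeasure_ae_norm_eq_one :
    ∀ᵐ ζ ∂(averageArcMeasure t α : Measure ℂ), ‖ζ‖ = 1 := by
  refine ae_norm_eq_one_of_sphere ?_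
  rw [averageArcMeasure_apply hα Metric.isClosed_sphere.measurableSet.compl]
  simp [arcMeasure_compl_sphere]

theorem integral_averageArcMeasure (ht : 0 < t) {g : ℂ → ℝ}
    (hg : Integrable g (averageArcMeasure t α : Measure ℂ)) :
    ∫ ζ, g ζ ∂(averageArcMeasure t α : Measure ℂ)
      = t⁻¹ * ∫ s in Set.Icc 0 t, ∫ ζ, g ζ ∂arcMeasure ‖α s‖ := by
  -- A kernel must be measurable in `s` everywhere, while `α` is only almost everywhere measurable;
  -- a measurable representative changes neither integral.
  have hm : Measurable fun s => arcMeasure ‖hα.mk α s‖ :=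
    measurable_arcMeasure.comp hα.measurable_mk.norm
  let κ : ProbabilityTheory.Kernel ℝ ℂ := ⟨fun s => arcMeasure ‖hα.mk α s‖, hm⟩
  have hae : (fun s => arcMeasure ‖α s‖) =ᵐ[volume.restrict (Set.Icc 0 t)] κ :=
    hα.ae_eq_mk.mono fun s hs => by
      change arcMeasure ‖α s‖ = arcMeasure ‖hα.mk α s‖
      rw [← hs]
  have hb : (averageArcMeasure t α : Measure ℂ) = (ENNReal.ofReal t)⁻¹ •
      (κ.comp (ProbabilityTheory.Kernel.const Unit (volume.restrict (Set.Icc 0 t)))) () := by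
    rw [ProbabilityTheory.Kernel.comp_apply, ProbabilityTheory.Kernel.const_apply,
      ← Measure.bind_congr_right hae]
    rfl
  have ht' : (ENNReal.ofReal t)⁻¹ ≠ 0 := by simp
  rw [hb] at hg ⊢
  have hg' := (integrable_smul_measure ht' (by simpa using ht)).1 hg
  rw [integral_smul_measure, ProbabilityTheory.Kernel.integral_comp hg',
    ProbabilityTheory.Kernel.const_apply, ENNReal.toReal_inv, ENNReal.toReal_ofReal ht.le,
    smul_eq_mul]
  congr 1
  refine integral_congr_ae (hae.mono fun s hs => ?_)
  simp only [← hs]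

/-- The potential of the averaged measure. -/
theorem integral_logKernel_averageArcMeasure (ht : 0 < t) {z : ℂ} (hz : ‖z‖ ≤ 1 / 4) :
    ∫ ζ, logKernel z ζ ∂(averageArcMeasure t α : Measure ℂ)
      = t⁻¹ * ∫ s in Set.Icc 0 t, ∫ ζ, logKernel z ζ ∂arcMeasure ‖α s‖ := by
  refine integral_averageArcMeasure hα ht ?_
  exact Integrable.of_bound measurable_logKernel.of_uncurry_left.aestronglyMeasurable 1
    ((averageArcMeasure_ae_norm_eq_one hα).mono fun ζ hζ => abs_logKernel_le hz hζ.le)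

end

/-- Convergence of the logarithmic potentials of the zero-counting measures. -/
theorem ratioLimit_integral_logKernel {t : ℝ} (ht : 0 < t) {α : ℝ → ℂ}
    (hα : AEMeasurable α (volume.restrict (Set.Icc 0 t)))
    (hα_le : ∀ s ∈ Set.Icc 0 t, ‖α s‖ ≤ 1) {a : ℕ → ℕ → ℂ} (ha : ∀ n N, ‖a n N‖ < 1)
    (hlim : ∀ᵐ s ∂(volume.restrict (Set.Icc 0 t)), RatioLimit a s (α s))
    {z : ℂ} (hz0 : z ≠ 0) (hz : ‖z‖ ≤ 1 / 4) :
    RatioLimit (fun n N => ∫ ζ, logKernel z ζ ∂(zeroMeasure (fun k => a k N) n : Measure ℂ)) t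
      (∫ ζ, logKernel z ζ ∂(averageArcMeasure t α : Measure ℂ)) := by
  have hz1 : ‖z‖ < 1 := by linarith
  rw [integral_logKernel_averageArcMeasure hα ht hz]
  simp_rw [fun n N => integral_logKernel_zeroMeasure (fun k => ha k N) n hz0 hz1,
    fun n N => log_norm_eval_reversed_opuc_eq_sum (fun k => ha k N) hz0 hz1.le n]
  refine ratioLimit_average (X := fun m N =>
    Real.log ‖1 - a m N * z * schurIterate (fun k => a k N) z m‖) (C := 1) ht (fun m N => ?_) ?_
  · exact abs_log_norm_one_sub_mul_mul_le hz (ha m N).le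
      (norm_schurIterate_le (fun k => ha k N) hz0 hz1.le m)
  filter_upwards [hlim, ae_restrict_mem measurableSet_Icc] with s hs hmem
  have hαs := hα_le s hmem
  obtain ⟨b, hb, hfix⟩ := exists_schurStep_eq_self hz hαs
  -- This places `w = 1 - α z b` near `1`, which singles it out from the other root of the
  -- quadratic.
  have hw : ‖1 - (1 - α s * z * b)‖ ≤ 1 / 4 := by
    rw [sub_sub_cancel]
    exact norm_mul_mul_le hz hαs hb
  rw [integral_logKernel_arcMeasure (norm_nonneg _) hαs hz hw
    (schurStep_fixed_quadratic hz hαs hb hfix)]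
  have h := hs.prodMk (ratioLimit_schurIterate ha hαs hs hz0 hz hb hfix)
  refine h.map (f := fun p : ℂ × ℂ => Real.log ‖1 - p.1 * z * p.2‖) ?_
  refine ContinuousAt.log (by fun_prop) ?_
  exact norm_ne_zero_iff.2 (one_sub_mul_mul_ne_zero hz hαs hb)

end VaryingOPUC

theorem theorem5p1 (t : ℝ) (ht : 0 < t) (α : ℝ → ℂ)
    (hα : AEMeasurable α (volume.restrict (Set.Icc 0 t)))
    (hα_le : ∀ s ∈ Set.Icc 0 t, ‖α s‖ ≤ 1)
    (a : ℕ → ℕ → ℂ) (ha : ∀ n N, ‖a n N‖ < 1)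
    (hlim : ∀ᵐ s ∂(volume.restrict (Set.Icc 0 t)), VaryingOPUC.RatioLimit a s (α s)) :
    VaryingOPUC.RatioLimit
      (fun n N => VaryingOPUC.balayage (VaryingOPUC.zeroMeasure (fun k => a k N) n))
      t (VaryingOPUC.averageArcMeasure t α) := by
  intro n N hn hN hs
  have hzero : ∀ j, ∀ᵐ ζ ∂(VaryingOPUC.zeroMeasure (fun k => a k (N j)) (n j) : Measure ℂ),
      ‖ζ‖ ≤ 1 := fun j => VaryingOPUC.zeroMeasure_ae_norm_le (fun k => ha k (N j)) (n j)
  have hav := VaryingOPUC.averageArcMeasure_ae_norm_eq_one hα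
  have hprob : ∀ᶠ j in atTop, IsProbabilityMeasure
      (VaryingOPUC.zeroMeasure (fun k => a k (N j)) (n j) : Measure ℂ) := by
    -- Finitely many `n_j` may be `0`, where the zero-counting measure is the zero measure.
    filter_upwards [hn.eventually_gt_atTop 0] with j hj
    exact VaryingOPUC.isProbabilityMeasure_zeroMeasure _ _ hj.ne'
  have := VaryingOPUC.isProbabilityMeasure_averageArcMeasure ht hα
  refine VaryingOPUC.tendsto_of_tendsto_integral_pow ?_ (fun j => ?_) hav fun k hk => ?_
  · filter_upwards [hprob] with j hj
    exact VaryingOPUC.isProbabilityMeasure_balayage _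
  · exact VaryingOPUC.ae_norm_eq_one_of_sphere (VaryingOPUC.balayage_sphere _ (hzero j))
  -- The zeros lie in the disk, so the balayage may be dropped from the moments; the limit measure
  -- already lives on the circle.
  · simp_rw [fun j => VaryingOPUC.integral_balayage_pow _ (hzero j) k]
    refine VaryingOPUC.tendsto_integral_pow_of_tendsto_logKernel hprob hzero
      (hav.mono fun ζ hζ => hζ.le) (fun z hz => ?_) hk
    have hz0 : z ≠ 0 := norm_pos_iff.1 (by rw [hz]; norm_num)
    exact VaryingOPUC.ratioLimit_integral_logKernel ht hα hα_le ha hlim hz0 hz.le n N hn hN hs
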